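/- Let $F$ be a field of characteristic zero and let $C=F(e_{11}+e_{22})\oplus Fe_{12}$ be the subalgebra of the algebra of $2\times2$ matrices over $F$ spanned by $e_{11}+e_{22}$ and $e_{12}$, where the $e_{ij}$ are the matrix units. Let $\varepsilon$ be the derivation of $C$ with $\varepsilon(\alpha(e_{11}+e_{22})+\beta e_{12})=\beta e_{12}$ for $\alpha,\beta\in F$. Let $L$ be a Lie algebra over $F$. An action of $L$ by derivations on an associative $F$-algebra $A$ is a homomorphism of Lie algebras $L\to\mathrm{Der}(A)$; it extends to the universal enveloping algebra $U(L)$. Fix a basis $\mathcal B$ of $U(L)$, and let $F\langle X|L\rangle$ be the free associative algebra (without $1$) on the generators $x_j^{h}$, $j\in\mathbb N$, $h\in\mathcal B$. Write $x_j^{h}$ also for arbitrary $h\in U(L)$, by linearity in $h$, and put $x_j=x_j^{1}$. Let $L$ act on $F\langle X|L\rangle$ by the derivations with $\gamma(x_j^h)=x_j^{\gamma h}$ for $\gamma\in L$. A $T_L$-ideal of $F\langle X|L\rangle$ is a two-sided ideal that is invariant under the action of $L$ and under all algebra endomorphisms of $F\langle X|L\rangle$ that commute with this action; $\langle S\rangle_{T_L}$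 denotes the smallest $T_L$-ideal containing $S$. For an algebra $A$ on which $L$ acts by derivations, $\mathrm{Id}^L(A)$ is the set of all $f\in F\langle X|L\rangle$ that vanish under every evaluation $x_j^h\mapsto h(a_j)$ with $a_j\in A$. Let $P_n^L$ be the span of the monomials $x_{\sigma(1)}^{h_1}\cdots x_{\sigma(n)}^{h_n}$ with $\sigma\in S_n$, $h_i\in\mathcal B$, on which $S_n$ acts by $\sigma(x_i^h)=x_{\sigma(i)}^h$. Then $c_n^L(A)$ and $\chi_n^L(A)$ are the dimension and the character of the $S_n$-module $P_n^L/(P_n^L\cap\mathrm{Id}^L(A))$. For a partition $\lambda$ of $n$, $\chi_\lambda$ is the irreducible character of $S_n$ over $F$ associated to $\lambda$. The derivation $\varepsilon$ spans $\mathrm{Der}(C)$. Let $C^\varepsilon$ be the algebra $C$ on which $L$ acts as $\mathrm{Der}(C)$, i.e. through a homomorphism of Lie algebras $\rho:L\to\mathrm{Der}(C)$ whose image contains $\varepsilon$. Let $e\in L$ with $\rho(e)=\varepsilon$, and write $x^\varepsilon$ for $x^{e}$ and $x^{\varepsilon^2}$ for $x^{e^2}$. Then, for distinct variables $x,y\in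 X$: 1. $\mathrm{Id}^L(C^\varepsilon)=\langle [x,y],\ x^\varepsilon y^\varepsilon,\ x^{\varepsilon^2}-x^\varepsilon\rangle_{T_L}$ if $\rho$ is injective (that is, if $L$ is identified with $\mathrm{Der}(C)$). In general the same holds once the trivial identities $x^\gamma$, $\gamma\in\ker\rho$, are added to the generators. 2. $c_n^L(C^\varepsilon)=n+1$ for all $n\ge 1$; in particular, $c_n^L(C^\varepsilon)$ grows linearly. 3. $\chi_n^L(C^\varepsilon)=2\chi_{(n)}+\chi_{(n-1,1)}$ for all $n\ge 2$, and $\chi_1^L(C^\varepsilon)=2\chi_{(1)}$. -/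

import Mathlib

attribute [local instance 100] LieRing.ofAssociativeRing

noncomputable section

namespace DiffPI

open Equiv

section Derivations

/-- `Der(A)`: the Lie algebra of all derivations of a (not necessarily unital or commutative)
associative `F`-algebra `A`, with the commutator bracket. -/
def Der (F A : Type*) [Field F] [NonUnitalRing A] [Module F A] [IsScalarTower F A A]
    [SMulCommClass F A A] : LieSubalgebra F (Module.End F A) where
  carrier := {D | ∀ a b : A, D (a * b) = D a * b + a * D b}
  add_mem' := by
    intro D E hD hE a b
    simp only [LinearMap.add_apply, hD a b, hE a b, add_mul, mul_add]
    abel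
  zero_mem' := by intro a b; simp
  smul_mem' := by
    intro c D hD a b
    simp only [LinearMap.smul_apply, hD a b, smul_add, smul_mul_assoc, mul_smul_comm]
  lie_mem' := by
    intro D E hD hE a b
    have hD' : ∀ a b : A, D (a * b) = D a * b + a * D b := hD
    have hE' : ∀ a b : A, E (a * b) = E a * b + a * E b := hE
    simp only [LieHom.lie_apply, Module.End.lie_apply, hD', hE', map_add, sub_mul, mul_sub]
    abel

variable {F L A : Type*} [Field F] [LieRing L] [LieAlgebra F L] [NonUnitalRing A] [Module F A]
  [IsScalarTower F A A] [SMulCommClass F A A]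

/-- An action of the Lie algebra `L` on `A` by derivations is a homomorphism of Lie algebras
`ρ : L → Der(A)`. This is its extension to an action of the enveloping algebra `U(L)`. -/
def envAction (ρ : L →ₗ⁅F⁆ Der F A) : UniversalEnvelopingAlgebra F L →ₐ[F] Module.End F A :=
  UniversalEnvelopingAlgebra.lift F ((Der F A).incl.comp ρ)

end Derivations

section FreeAlgebra

/-- The free associative `F`-algebra (without unit) on the generators `x_j^{h_i}`,
`j ∈ ℕ`, `i ∈ I`, where `(h_i)_{i ∈ I}` is a basis of `U(L)`. This is the algebra
underlying the free algebra with derivations `F⟨X|L⟩`. -/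
abbrev FreeDiffAlg (F I : Type*) [Field F] : Type _ := MonoidAlgebra F (FreeSemigroup (ℕ × I))

variable {F I : Type*} [Field F]

/-- The monomial with coefficient one attached to a nonempty word. -/
def mono (F : Type*) {I : Type*} [Field F] (w : FreeSemigroup (ℕ × I)) : FreeDiffAlg F I :=
  MonoidAlgebra.single w 1

theorem mono_mul (v w : FreeSemigroup (ℕ × I)) : mono F (v * w) = mono F v * mono F w := by
  simp [mono, MonoidAlgebra.single_mul_single]

theorem linearMap_ext {M : Type*} [AddCommMonoid M] [Module F M] {f g : FreeDiffAlg F I →ₗ[F] M}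
    (h : ∀ w, f (mono F w) = g (mono F w)) : f = g := by
  apply LinearMap.ext
  intro x
  induction x using MonoidAlgebra.induction_linear with
  | zero => simp
  | add x y hx hy => simp [hx, hy]
  | single w c =>
    have : (MonoidAlgebra.single w c : FreeDiffAlg F I) = c • mono F w := by simp [mono]
    rw [this, map_smul, map_smul, h]

/-- The homomorphism out of the free algebra with prescribed values on the generators. -/
def freeLift {A : Type*} [NonUnitalRing A] [Module F A] [IsScalarTower F A A]
    [SMulCommClass F A A] (g : ℕ × I → A) : FreeDiffAlg F I →ₙₐ[F] A :=
  MonoidAlgebra.liftMagma F (FreeSemigroup.lift g)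

theorem freeLift_mono {A : Type*} [NonUnitalRing A] [Module F A] [IsScalarTower F A A]
    [SMulCommClass F A A] (g : ℕ × I → A) (w : FreeSemigroup (ℕ × I)) :
    freeLift g (mono F w) = FreeSemigroup.lift g w := by
  simp [freeLift, mono]

/-- The value on a word `y₁ y₂ ⋯ yₙ` of the derivation with values `d` on the generators:
`d(y₁) y₂ ⋯ yₙ + y₁ d(y₂) ⋯ yₙ + ⋯ + y₁ y₂ ⋯ d(yₙ)`. -/
def derWord (d : ℕ × I → FreeDiffAlg F I) : ℕ × I → List (ℕ × I) → FreeDiffAlg F I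
  | a, [] => d a
  | a, b :: l => d a * mono F ⟨b, l⟩ + mono F (FreeSemigroup.of a) * derWord d b l

/-- The derivation of the free algebra with prescribed values on the generators,
as a linear map. -/
def freeDer (d : ℕ × I → FreeDiffAlg F I) : FreeDiffAlg F I →ₗ[F] FreeDiffAlg F I :=
  (Finsupp.linearCombination F fun w : FreeSemigroup (ℕ × I) => derWord d w.head w.tail) ∘ₗ
    (MonoidAlgebra.coeffLinearEquiv F).toLinearMap

theorem freeDer_mono (d : ℕ × I → FreeDiffAlg F I) (w : FreeSemigroup (ℕ × I)) :
    freeDer d (mono F w) = derWord d w.head w.tail := by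
  simp [freeDer, mono]

theorem freeDer_of (d : ℕ × I → FreeDiffAlg F I) (y : ℕ × I) :
    freeDer d (mono F (FreeSemigroup.of y)) = d y := by
  rw [freeDer_mono]; rfl

theorem freeDer_mono_mul (d : ℕ × I → FreeDiffAlg F I) (v w : FreeSemigroup (ℕ × I)) :
    freeDer d (mono F v * mono F w) =
      freeDer d (mono F v) * mono F w + mono F v * freeDer d (mono F w) := by
  have hcons : ∀ (y : ℕ × I) (w : FreeSemigroup (ℕ × I)),
      freeDer d (mono F (FreeSemigroup.of y * w)) =
        d y * mono F w + mono F (FreeSemigroup.of y) * freeDer d (mono F w) := by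
    intro y w
    rw [freeDer_mono, freeDer_mono]
    rfl
  induction v using FreeSemigroup.recOnMul with
  | ih1 y => rw [← mono_mul, hcons, freeDer_of]
  | ih2 y v _ ih =>
    rw [← mono_mul, mul_assoc, hcons, hcons, mono_mul, ih, mono_mul]
    simp only [mul_add, add_mul, mul_assoc, add_assoc]

theorem freeDer_mem_Der (d : ℕ × I → FreeDiffAlg F I) : freeDer d ∈ Der F (FreeDiffAlg F I) := by
  have key : (LinearMap.mul F (FreeDiffAlg F I)).compr₂ (freeDer d) =
      (LinearMap.mul F (FreeDiffAlg F I)).comp (freeDer d) +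
        (LinearMap.mul F (FreeDiffAlg F I)).compl₂ (freeDer d) := by
    apply linearMap_ext
    intro v
    apply linearMap_ext
    intro w
    simpa using freeDer_mono_mul d v w
  intro a b
  simpa using congrArg (fun f => f a b) key

theorem Der_free_ext {D E : Der F (FreeDiffAlg F I)}
    (h : ∀ y, D.1 (mono F (FreeSemigroup.of y)) = E.1 (mono F (FreeSemigroup.of y))) : D = E := by
  apply Subtype.ext
  apply linearMap_ext
  intro w
  induction w using FreeSemigroup.recOnMul with
  | ih1 y => exact h y
  | ih2 y v h1 h2 => rw [mono_mul, D.2, E.2, h1, h2]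

end FreeAlgebra

section DifferentialIdentities

variable {F L I : Type*} [Field F] [LieRing L] [LieAlgebra F L]

/-- The differential variable `x_j^h` for an arbitrary `h ∈ U(L)`, expanded linearly in the chosen
basis of `U(L)`. -/
def var (b : Module.Basis I F (UniversalEnvelopingAlgebra F L)) (j : ℕ) :
    UniversalEnvelopingAlgebra F L →ₗ[F] FreeDiffAlg F I :=
  (Finsupp.linearCombination F fun i => mono F (FreeSemigroup.of (j, i))) ∘ₗ b.repr.toLinearMap

theorem var_basis (b : Module.Basis I F (UniversalEnvelopingAlgebra F L)) (j : ℕ) (i : I) :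
    var b j (b i) = mono F (FreeSemigroup.of (j, i)) := by
  simp [var]

/-- The endomorphism of the free algebra induced by `γ ∈ L`: the derivation such that
`γ(x_j^{h_i}) = x_j^{γ h_i}`. -/
def freeActionAux (b : Module.Basis I F (UniversalEnvelopingAlgebra F L)) (γ : L) :
    Der F (FreeDiffAlg F I) :=
  ⟨freeDer fun y => var b y.1 (UniversalEnvelopingAlgebra.ι F γ * b y.2), freeDer_mem_Der _⟩

theorem freeActionAux_var (b : Module.Basis I F (UniversalEnvelopingAlgebra F L)) (γ : L) (j : ℕ)
    (h : UniversalEnvelopingAlgebra F L) :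
    (freeActionAux b γ).1 (var b j h) = var b j (UniversalEnvelopingAlgebra.ι F γ * h) := by
  have key : (freeActionAux b γ).1 ∘ₗ var b j =
      var b j ∘ₗ LinearMap.mulLeft F (UniversalEnvelopingAlgebra.ι F γ) := by
    apply b.ext
    intro i
    simp only [LinearMap.comp_apply, var_basis, LinearMap.mulLeft_apply]
    exact freeDer_of _ _
  exact congrArg (fun f => f h) key

/-- The action of `L` by derivations that makes the free algebra into the free algebra with
derivations `F⟨X|L⟩`. -/
def freeAction (b : Module.Basis I F (UniversalEnvelopingAlgebra F L)) :
    L →ₗ⁅F⁆ Der F (FreeDiffAlg F I) where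
  toFun := freeActionAux b
  map_add' γ γ' := by
    apply Der_free_ext
    rintro ⟨j, i⟩
    rw [← var_basis b]
    change _ = (freeActionAux b γ).1 _ + (freeActionAux b γ').1 _
    simp only [freeActionAux_var, map_add, add_mul]
  map_smul' c γ := by
    apply Der_free_ext
    rintro ⟨j, i⟩
    rw [← var_basis b]
    change _ = c • (freeActionAux b γ).1 _
    simp only [freeActionAux_var, map_smul, smul_mul_assoc]
  map_lie' := by
    intro γ γ'
    apply Der_free_ext
    rintro ⟨j, i⟩
    rw [← var_basis b]
    change _ = (freeActionAux b γ).1 ((freeActionAux b γ').1 _) -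
      (freeActionAux b γ').1 ((freeActionAux b γ).1 _)
    simp only [freeActionAux_var, LieHom.map_lie, LieRing.of_associative_ring_bracket, sub_mul,
      mul_assoc, map_sub]

/-- A `T_L`-ideal of `F⟨X|L⟩`: a two-sided ideal that is invariant under the action of `L`
(equivalently, of `U(L)`) and under all substitutions, i.e. under all endomorphisms of the algebra
`F⟨X|L⟩` that commute with the action of `L`. -/
structure IsTLIdeal (b : Module.Basis I F (UniversalEnvelopingAlgebra F L))
    (Q : Submodule F (FreeDiffAlg F I)) : Prop where
  mul_left : ∀ g f, f ∈ Q → g * f ∈ Q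
  mul_right : ∀ g f, f ∈ Q → f * g ∈ Q
  action : ∀ (γ : L) f, f ∈ Q → (freeAction b γ).1 f ∈ Q
  substitution : ∀ φ : FreeDiffAlg F I →ₙₐ[F] FreeDiffAlg F I,
    (∀ (γ : L) f, φ ((freeAction b γ).1 f) = (freeAction b γ).1 (φ f)) → ∀ f, f ∈ Q → φ f ∈ Q

/-- The `T_L`-ideal `⟨S⟩_{T_L}` generated by a set `S` of differential polynomials: the
intersection of all `T_L`-ideals that contain `S`. -/
def tlSpan (b : Module.Basis I F (UniversalEnvelopingAlgebra F L)) (S : Set (FreeDiffAlg F I)) :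
    Submodule F (FreeDiffAlg F I) :=
  sInf {Q | IsTLIdeal b Q ∧ S ⊆ Q}

variable {A : Type*} [NonUnitalRing A] [Module F A] [IsScalarTower F A A] [SMulCommClass F A A]

/-- Evaluation `f ↦ f(a₀, a₁, …)` of differential polynomials in an `L`-algebra: the homomorphism
with `x_j^{h_i} ↦ h_i(a_j)`. -/
def evalAt (ρ : L →ₗ⁅F⁆ Der F A) (b : Module.Basis I F (UniversalEnvelopingAlgebra F L))
    (a : ℕ → A) : FreeDiffAlg F I →ₙₐ[F] A :=
  freeLift fun y => envAction ρ (b y.2) (a y.1)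

/-- `Id^L(A)`: the differential identities of the `L`-algebra `A`. -/
def diffId (ρ : L →ₗ⁅F⁆ Der F A) (b : Module.Basis I F (UniversalEnvelopingAlgebra F L)) :
    Submodule F (FreeDiffAlg F I) where
  carrier := {f | ∀ a : ℕ → A, evalAt ρ b a f = 0}
  add_mem' hf hg a := by rw [map_add, hf a, hg a, add_zero]
  zero_mem' a := map_zero _
  smul_mem' c f hf a := by rw [map_smul, hf a, smul_zero]

/-- `P_n^L`: the multilinear differential polynomials in the variables `x_0, …, x_{n-1}`, spanned
by the monomials `x_{σ(0)}^{h_0} ⋯ x_{σ(n-1)}^{h_{n-1}}` with `σ ∈ S_n` and basis elements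
`h_k` of `U(L)`. -/
def multilinear (F I : Type*) [Field F] (n : ℕ) : Submodule F (FreeDiffAlg F I) :=
  Submodule.span F {f | ∃ (σ : Perm (Fin n)) (h : Fin n → I) (w : FreeSemigroup (ℕ × I)),
    w.head :: w.tail = List.ofFn (fun k => ((σ k : ℕ), h k)) ∧ f = mono F w}

/-- A permutation of `{0, …, n-1}` as a permutation of the indices of all variables. -/
def permNat (n : ℕ) : Perm (Fin n) →* Perm ℕ :=
  Equiv.Perm.extendDomainHom Fin.equivSubtype

theorem permNat_apply {n : ℕ} (σ : Perm (Fin n)) (k : Fin n) : permNat n σ k = σ k := by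
  have := Equiv.Perm.extendDomain_apply_image σ Fin.equivSubtype k
  simpa [permNat] using this

/-- The algebra endomorphism `x_j^h ↦ x_{τ(j)}^h` renaming the variables. -/
def rename (F : Type*) {I : Type*} [Field F] (τ : ℕ → ℕ) : FreeDiffAlg F I →ₙₐ[F] FreeDiffAlg F I :=
  freeLift fun y => mono F (FreeSemigroup.of (τ y.1, y.2))

theorem rename_mono (τ : ℕ → ℕ) (w : FreeSemigroup (ℕ × I)) :
    rename F τ (mono F w) = mono F (FreeSemigroup.map (Prod.map τ id) w) := by
  rw [rename, freeLift_mono]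
  induction w using FreeSemigroup.recOnMul with
  | ih1 y => rfl
  | ih2 y v h1 h2 => rw [map_mul, h1, h2, map_mul, mono_mul]

/-- The left action of `S_n` on differential polynomials, `σ(x_j^h) = x_{σ(j)}^h`. -/
def permAction (F I : Type*) [Field F] (n : ℕ) :
    Representation F (Perm (Fin n)) (FreeDiffAlg F I) where
  toFun σ := (rename F (I := I) (permNat n σ) : FreeDiffAlg F I →ₗ[F] FreeDiffAlg F I)
  map_one' := by
    apply linearMap_ext
    intro w
    have : FreeSemigroup.map (Prod.map (id : ℕ → ℕ) (id : I → I)) w = w := by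
      induction w using FreeSemigroup.recOnMul with
      | ih1 y => rfl
      | ih2 y v h1 h2 => rw [map_mul, h1, h2]
    simpa [rename_mono] using congrArg (mono F) this
  map_mul' σ τ := by
    apply linearMap_ext
    intro w
    have : FreeSemigroup.map (Prod.map (permNat n (σ * τ)) id) w =
        FreeSemigroup.map (Prod.map (permNat n σ) (id : I → I))
          (FreeSemigroup.map (Prod.map (permNat n τ) id) w) := by
      induction w using FreeSemigroup.recOnMul with
      | ih1 y => simp [Prod.map]
      | ih2 y v h1 h2 => rw [map_mul, h1, h2, ← map_mul, ← map_mul]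
    simpa [rename_mono] using congrArg (mono F) this

theorem multilinear_invariant (n : ℕ) (σ : Perm (Fin n)) :
    multilinear F I n ≤ (multilinear F I n).comap (permAction F I n σ) := by
  rw [multilinear, Submodule.span_le]
  rintro _ ⟨τ, h, w, hw, rfl⟩
  apply Submodule.subset_span
  refine ⟨σ * τ, h, FreeSemigroup.map (Prod.map (permNat n σ) id) w, ?_, rename_mono _ _⟩
  have hmap : ∀ w : FreeSemigroup (ℕ × I),
      (FreeSemigroup.map (Prod.map (permNat n σ) id) w).head ::
        (FreeSemigroup.map (Prod.map (permNat n σ) id) w).tail =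
      (w.head :: w.tail).map (Prod.map (permNat n σ) id) := by
    intro w
    induction w using FreeSemigroup.recOnMul with
    | ih1 y => rfl
    | ih2 y v h1 h2 =>
      rw [map_mul]
      simp only [FreeSemigroup.head_mul, FreeSemigroup.tail_mul, FreeSemigroup.map_of] at h2 ⊢
      simp [h2]
  rw [hmap, hw, List.map_ofFn]
  congr 1
  funext k
  simp [permNat_apply]

theorem evalAt_rename (ρ : L →ₗ⁅F⁆ Der F A)
    (b : Module.Basis I F (UniversalEnvelopingAlgebra F L)) (a : ℕ → A) (τ : ℕ → ℕ)
    (f : FreeDiffAlg F I) : evalAt ρ b a (rename F τ f) = evalAt ρ b (fun j => a (τ j)) f := by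
  have key : (evalAt ρ b a : FreeDiffAlg F I →ₗ[F] A) ∘ₗ
      (rename F (I := I) τ : FreeDiffAlg F I →ₗ[F] FreeDiffAlg F I) =
      (evalAt ρ b (fun j => a (τ j)) : FreeDiffAlg F I →ₗ[F] A) := by
    apply linearMap_ext
    intro w
    simp only [LinearMap.comp_apply, LinearMap.coe_coe, rename_mono, evalAt, freeLift_mono]
    induction w using FreeSemigroup.recOnMul with
    | ih1 y => rfl
    | ih2 y v h1 h2 => rw [map_mul, map_mul, map_mul, h1, h2]
  exact congrArg (fun g => g f) key

/-- `P_n^L ∩ Id^L(A)`, as a subspace of `P_n^L`. -/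
def multilinearId (ρ : L →ₗ⁅F⁆ Der F A) (b : Module.Basis I F (UniversalEnvelopingAlgebra F L))
    (n : ℕ) : Submodule F (multilinear F I n) :=
  (diffId ρ b).comap (multilinear F I n).subtype

theorem multilinearId_invariant (ρ : L →ₗ⁅F⁆ Der F A)
    (b : Module.Basis I F (UniversalEnvelopingAlgebra F L)) (n : ℕ) (σ : Perm (Fin n)) :
    multilinearId ρ b n ≤ (multilinearId ρ b n).comap
      ((permAction F I n).subrepresentation (multilinear F I n) (multilinear_invariant n) σ) := by
  intro f hf a
  exact (evalAt_rename ρ b a (permNat n σ) f.1).trans (hf _)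

/-- The `S_n`-module `P_n^L(A) = P_n^L / (P_n^L ∩ Id^L(A))`. -/
def cocharModule (ρ : L →ₗ⁅F⁆ Der F A) (b : Module.Basis I F (UniversalEnvelopingAlgebra F L))
    (n : ℕ) : Representation F (Perm (Fin n)) (multilinear F I n ⧸ multilinearId ρ b n) :=
  ((permAction F I n).subrepresentation (multilinear F I n) (multilinear_invariant n)).quotient
    (multilinearId ρ b n) (multilinearId_invariant ρ b n)

/-- The `n`-th differential codimension `c_n^L(A) = dim P_n^L(A)`. -/
def codim (ρ : L →ₗ⁅F⁆ Der F A) (b : Module.Basis I F (UniversalEnvelopingAlgebra F L))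
    (n : ℕ) : Cardinal :=
  Module.rank F (multilinear F I n ⧸ multilinearId ρ b n)

/-- The `n`-th differential cocharacter `χ_n^L(A)`: the character of the `S_n`-module
`P_n^L(A)`. -/
def cocharacter (ρ : L →ₗ⁅F⁆ Der F A) (b : Module.Basis I F (UniversalEnvelopingAlgebra F L))
    (n : ℕ) : Perm (Fin n) → F :=
  (cocharModule ρ b n).character

end DifferentialIdentities

section Specht

/-- The permutation representation of `S_n` on row assignments `r : {0, …, n-1} → ℕ`, where
`r i` is the row that contains the entry `i`: `(σ r)(i) = r(σ⁻¹ i)`. Row assignments encode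
tabloids (tableaux up to permutations of the entries within the rows). -/
def tabloidRep (F : Type*) [Field F] (n : ℕ) :
    Representation F (Perm (Fin n)) ((Fin n → ℕ) →₀ F) where
  toFun σ := Finsupp.lmapDomain F F fun r : Fin n → ℕ => r ∘ ⇑σ⁻¹
  map_one' := by
    apply Finsupp.lhom_ext
    intro r c
    simp [Finsupp.mapDomain_single]
  map_mul' σ τ := by
    apply Finsupp.lhom_ext
    intro r c
    simp [Finsupp.mapDomain_single, Function.comp_assoc]

/-- A (not necessarily standard) tableau of shape `μ` with entries `0, …, n-1`, given by the
position of each entry. -/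
abbrev Tableau (n : ℕ) (μ : YoungDiagram) : Type := Fin n ≃ μ.cells

/-- The row that contains the entry `i`. -/
def Tableau.row {n : ℕ} {μ : YoungDiagram} (T : Tableau n μ) (i : Fin n) : ℕ := (T i).1.1

/-- The column that contains the entry `i`. -/
def Tableau.col {n : ℕ} {μ : YoungDiagram} (T : Tableau n μ) (i : Fin n) : ℕ := (T i).1.2

open scoped Classical in
/-- The polytabloid `e_T = ∑ sgn(γ) {γ T}`, the sum being over the column stabilizer of `T`. -/
def polytabloid (F : Type*) [Field F] {n : ℕ} {μ : YoungDiagram} (T : Tableau n μ) :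
    (Fin n → ℕ) →₀ F :=
  ∑ γ : Perm (Fin n) with ∀ i, T.col (γ i) = T.col i,
    ((Equiv.Perm.sign γ : ℤ) : F) • tabloidRep F n γ (Finsupp.single T.row 1)

/-- The Specht module `S^μ`, spanned by the polytabloids of all tableaux of shape `μ`. -/
def specht (F : Type*) [Field F] (n : ℕ) (μ : YoungDiagram) : Submodule F ((Fin n → ℕ) →₀ F) :=
  Submodule.span F (Set.range fun T : Tableau n μ => polytabloid F T)

theorem tabloidRep_polytabloid (F : Type*) [Field F] {n : ℕ} {μ : YoungDiagram}
    (T : Tableau n μ) (σ : Perm (Fin n)) :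
    tabloidRep F n σ (polytabloid F T) = polytabloid F (σ⁻¹.trans T : Tableau n μ) := by
  classical
  have hrow : Finsupp.single (Tableau.row (σ⁻¹.trans T : Tableau n μ)) (1 : F) =
      tabloidRep F n σ (Finsupp.single T.row 1) := by
    simp only [tabloidRep, MonoidHom.coe_mk, OneHom.coe_mk, Finsupp.lmapDomain_apply,
      Finsupp.mapDomain_single]
    rfl
  simp only [polytabloid, map_sum, map_smul, hrow]
  refine Finset.sum_bij (fun γ _ => σ * γ * σ⁻¹) ?_ ?_ ?_ ?_
  · intro γ hγ
    simp only [Finset.mem_filter, Finset.mem_univ, true_and] at hγ ⊢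
    intro i
    simpa [Tableau.col] using hγ (σ⁻¹ i)
  · intro γ _ γ' _ h
    simpa using h
  · intro γ hγ
    simp only [Finset.mem_filter, Finset.mem_univ, true_and] at hγ
    refine ⟨σ⁻¹ * γ * σ, ?_, by group⟩
    simp only [Finset.mem_filter, Finset.mem_univ, true_and]
    intro i
    simpa [Tableau.col] using hγ (σ i)
  · intro γ _
    have hsign : Equiv.Perm.sign (σ * γ * σ⁻¹) = Equiv.Perm.sign γ := by
      rw [map_mul, map_mul, Equiv.Perm.sign_inv, mul_right_comm, Int.units_mul_self, one_mul]
    rw [hsign, ← Module.End.mul_apply, ← Module.End.mul_apply, ← map_mul, ← map_mul]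
    simp [mul_assoc]

theorem specht_invariant (F : Type*) [Field F] (n : ℕ) (μ : YoungDiagram) (σ : Perm (Fin n)) :
    specht F n μ ≤ (specht F n μ).comap (tabloidRep F n σ) := by
  rw [specht, Submodule.span_le]
  rintro _ ⟨T, rfl⟩
  exact Submodule.subset_span ⟨_, (tabloidRep_polytabloid F T σ).symm⟩

/-- `χ_μ`: the irreducible character of `S_n` associated to the partition `μ` of `n`, i.e. the
character of the Specht module `S^μ`. -/
def irrChar (F : Type*) [Field F] (n : ℕ) (μ : YoungDiagram) : Perm (Fin n) → F :=
  Representation.character (V := specht F n μ)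
    ((tabloidRep F n).subrepresentation (specht F n μ) (specht_invariant F n μ))

/-- The Young diagram of the partition `(n)`. -/
def rowShape (n : ℕ) : YoungDiagram := YoungDiagram.ofRowLens [n] (by simp [List.sortedGE_iff_pairwise])

/-- The Young diagram of the partition `(n - 1, 1)`, for `2 ≤ n`. -/
def hookShape (n : ℕ) (hn : 2 ≤ n) : YoungDiagram :=
  YoungDiagram.ofRowLens [n - 1, 1] (by simp [List.sortedGE_iff_pairwise]; omega)

end Specht

section AlgebraC

variable (F : Type*) [Field F]

/-- The algebra `C = F(e₁₁ + e₂₂) ⊕ F e₁₂` of `2 × 2` matrices. -/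
def algC : Subalgebra F (Matrix (Fin 2) (Fin 2) F) where
  carrier := {M | ∃ α β : F, M = α • (Matrix.single 0 0 1 + Matrix.single 1 1 1) +
    β • Matrix.single 0 1 1}
  mul_mem' := by
    rintro _ _ ⟨α, β, rfl⟩ ⟨α', β', rfl⟩
    refine ⟨α * α', α * β' + β * α', ?_⟩
    ext i j
    fin_cases i <;> fin_cases j <;> simp [Matrix.mul_apply, Matrix.single]
  add_mem' := by
    rintro _ _ ⟨α, β, rfl⟩ ⟨α', β', rfl⟩
    exact ⟨α + α', β + β', by module⟩
  algebraMap_mem' r := by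
    refine ⟨r, 0, ?_⟩
    ext i j
    fin_cases i <;> fin_cases j <;> simp [Matrix.single, Matrix.algebraMap_matrix_apply]

/-- The element `α (e₁₁ + e₂₂) + β e₁₂` of `C`. -/
def mkC (α β : F) : algC F :=
  ⟨α • (Matrix.single 0 0 1 + Matrix.single 1 1 1) + β • Matrix.single 0 1 1, α, β, rfl⟩

theorem mkC_entry (α β : F) : (mkC F α β).1 0 1 = β := by
  simp [mkC, Matrix.single]

theorem mkC_mul (α β α' β' : F) :
    mkC F α β * mkC F α' β' = mkC F (α * α') (α * β' + β * α') := by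
  apply Subtype.ext
  ext i j
  fin_cases i <;> fin_cases j <;> simp [mkC, Matrix.mul_apply, Matrix.single]

theorem mkC_add (α β α' β' : F) : mkC F α β + mkC F α' β' = mkC F (α + α') (β + β') := by
  apply Subtype.ext
  change α • _ + β • _ + (α' • _ + β' • _) = (α + α') • _ + (β + β') • _
  module

/-- The linear map `α (e₁₁ + e₂₂) + β e₁₂ ↦ β e₁₂` of `C`. -/
def epsLin : Module.End F (algC F) where
  toFun M := mkC F 0 (M.1 0 1)
  map_add' M N := by
    apply Subtype.ext
    simp [mkC, add_smul]
  map_smul' c M := by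
    apply Subtype.ext
    simp [mkC, mul_smul]

theorem epsLin_mkC (α β : F) : epsLin F (mkC F α β) = mkC F 0 β :=
  congrArg (mkC F 0) (mkC_entry F α β)

/-- The derivation `ε` of `C`. -/
def eps : Der F (algC F) :=
  ⟨epsLin F, by
    rintro ⟨_, α, β, rfl⟩ ⟨_, α', β', rfl⟩
    change epsLin F (mkC F α β * mkC F α' β') =
      epsLin F (mkC F α β) * mkC F α' β' + mkC F α β * epsLin F (mkC F α' β')
    rw [mkC_mul, epsLin_mkC, epsLin_mkC, epsLin_mkC, mkC_mul, mkC_mul]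
    rw [mkC_add]
    congr 1 <;> ring⟩

variable {F} {L I : Type*} [LieRing L] [LieAlgebra F L]

/-- The three differential polynomials `[x,y]`, `x^ε y^ε`, `x^{ε²} - x^ε`, where `x = x_0`,
`y = x_1` and `e ∈ L` is an element that acts as `ε`. -/
def gensC (b : Module.Basis I F (UniversalEnvelopingAlgebra F L)) (e : L) :
    Set (FreeDiffAlg F I) :=
  let u := UniversalEnvelopingAlgebra.ι F e
  {var b 0 1 * var b 1 1 - var b 1 1 * var b 0 1,
    var b 0 u * var b 1 u,
    var b 0 (u ^ 2) - var b 0 u}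

end AlgebraC

end DiffPI

end

/-! Identities. The generators lie in `Id^L(C)`, so only the reverse inclusion needs an argument.
Every derivation of `C` is a multiple of `ε`. Modulo a `T_L`-ideal `T` of identities that contains
the generators and the `x^γ` with `γ ∈ ker ρ`, the variables commute, each `x_j^h` is a combination
of `X_j = x_j` and `Y_j = x_j^ε` (because `ε² = ε`), and `Y_i Y_j = 0`. So each `f` is congruent to
some `p(X) + ∑ q_j(X) Y_j`. At `a_j = α_j + β_j e₁₂` the scalar part of this is `p(α)`, and once `p
= 0` its `e₁₂` part is `∑ q_j(α) β_j`. An identity therefore has `p = 0` and all `q_j = 0`, since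
`F` is infinite, and lies in `T` (`exists_var_congr`, `exists_normalForm`, `normalForm_eq_zero`).

Codimensions and cocharacters. `U(L)` acts on `C` diagonally, so a multilinear `f` takes at `x_k +
y_k e₁₂` the value `c ∏ x_k + (∑ d_j y_j ∏_{k≠j} x_k) e₁₂`. The pair `(c, d)` determines `f` modulo
identities, every pair in `F × Fⁿ` occurs, and `S_n` fixes `c` and permutes `d`. Hence `P_n^L(C)` is
the trivial module plus the permutation module `Fⁿ`. Its dimension is `n + 1`, and for `n ≥ 2` the
vectors of coordinate sum zero in `Fⁿ` form the Specht module of `(n-1,1)` (`components_surjective`,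
`components_permAction`, `irrChar_hookShape`). -/

noncomputable section

namespace DiffPI

open Equiv

/-! ### Enveloping algebras, evaluations and `T_L`-ideals -/

section General

variable {F L I : Type*} [Field F] [LieRing L] [LieAlgebra F L]

/-- By the universal property, lifting `ι` to `S` and then including `S` gives the identity, so
every element comes from `S`. -/
theorem subalgebra_eq_top_of_ι_mem (S : Subalgebra F (UniversalEnvelopingAlgebra F L))
    (hS : ∀ γ : L, UniversalEnvelopingAlgebra.ι F γ ∈ S) : S = ⊤ := by
  let g : L →ₗ⁅F⁆ S :=
    { toFun := fun γ => ⟨UniversalEnvelopingAlgebra.ι F γ, hS γ⟩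
      map_add' := fun x y => Subtype.ext (map_add _ x y)
      map_smul' := fun c x => Subtype.ext (map_smul _ c x)
      map_lie' := by
        intro x y
        apply Subtype.ext
        simp only [LieHom.map_lie, LieRing.of_associative_ring_bracket]
        rfl }
  have key : S.val.comp (UniversalEnvelopingAlgebra.lift F g) = AlgHom.id F _ := by
    apply UniversalEnvelopingAlgebra.hom_ext
    apply LieHom.ext
    intro x
    change ((UniversalEnvelopingAlgebra.lift F g (UniversalEnvelopingAlgebra.ι F x) : S) :
      UniversalEnvelopingAlgebra F L) = UniversalEnvelopingAlgebra.ι F x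
    rw [UniversalEnvelopingAlgebra.lift_ι_apply]
    rfl
  refine eq_top_iff.2 fun h _ => ?_
  have := congrArg (fun f => f h) key
  simp only [AlgHom.comp_apply, AlgHom.id_apply] at this
  rw [← this]
  exact (UniversalEnvelopingAlgebra.lift F g h).2

theorem envelopingAlgebra_induction {P : UniversalEnvelopingAlgebra F L → Prop}
    (algebraMap : ∀ c : F, P (algebraMap F _ c))
    (ι : ∀ γ : L, P (UniversalEnvelopingAlgebra.ι F γ))
    (add : ∀ g h, P g → P h → P (g + h)) (mul : ∀ g h, P g → P h → P (g * h))
    (h : UniversalEnvelopingAlgebra F L) : P h := by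
  let S : Subalgebra F (UniversalEnvelopingAlgebra F L) :=
    { carrier := {h | P h}
      mul_mem' := mul _ _
      add_mem' := add _ _
      algebraMap_mem' := algebraMap }
  have : h ∈ S := by rw [subalgebra_eq_top_of_ι_mem S ι]; trivial
  exact this

theorem algHom_ext_var (b : Module.Basis I F (UniversalEnvelopingAlgebra F L))
    {A : Type*} [NonUnitalRing A] [Module F A] {φ ψ : FreeDiffAlg F I →ₙₐ[F] A} (h : ∀ j i, φ (var b j (b i)) = ψ (var b j (b i))) :
    φ = ψ := by
  have key : (φ : FreeDiffAlg F I →ₗ[F] A) = ψ := by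
    apply linearMap_ext
    intro w
    simp only [LinearMap.coe_coe]
    induction w using FreeSemigroup.recOnMul with
    | ih1 y => simpa only [var_basis] using h y.1 y.2
    | ih2 y v h1 h2 => rw [mono_mul, map_mul, map_mul, h1, h2]
  exact NonUnitalAlgHom.ext fun x => congrArg (fun g => g x) key

variable {A : Type*} [NonUnitalRing A] [Module F A] [IsScalarTower F A A] [SMulCommClass F A A]

theorem envAction_ι (ρ : L →ₗ⁅F⁆ Der F A) (γ : L) :
    envAction ρ (UniversalEnvelopingAlgebra.ι F γ) = (ρ γ).1 :=
  UniversalEnvelopingAlgebra.lift_ι_apply F _ γ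

theorem evalAt_mono_of (ρ : L →ₗ⁅F⁆ Der F A)
    (b : Module.Basis I F (UniversalEnvelopingAlgebra F L)) (a : ℕ → A) (y : ℕ × I) :
    evalAt ρ b a (mono F (FreeSemigroup.of y)) = envAction ρ (b y.2) (a y.1) := by
  rw [evalAt, freeLift_mono]; rfl

theorem evalAt_var (ρ : L →ₗ⁅F⁆ Der F A)
    (b : Module.Basis I F (UniversalEnvelopingAlgebra F L)) (a : ℕ → A) (j : ℕ)
    (h : UniversalEnvelopingAlgebra F L) : evalAt ρ b a (var b j h) = envAction ρ h (a j) := by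
  have key : (evalAt ρ b a : FreeDiffAlg F I →ₗ[F] A) ∘ₗ var b j =
      (LinearMap.applyₗ (a j)) ∘ₗ (envAction ρ).toLinearMap := by
    apply b.ext
    intro i
    simp only [LinearMap.comp_apply, var_basis]
    exact evalAt_mono_of ρ b a (j, i)
  exact congrArg (fun f => f h) key

theorem evalAt_freeAction (ρ : L →ₗ⁅F⁆ Der F A)
    (b : Module.Basis I F (UniversalEnvelopingAlgebra F L)) (a : ℕ → A) (γ : L)
    (f : FreeDiffAlg F I) :
    evalAt ρ b a ((freeAction b γ).1 f) = (ρ γ).1 (evalAt ρ b a f) := by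
  have key : (evalAt ρ b a : FreeDiffAlg F I →ₗ[F] A) ∘ₗ (freeAction b γ).1 =
      (ρ γ).1 ∘ₗ (evalAt ρ b a : FreeDiffAlg F I →ₗ[F] A) := by
    apply linearMap_ext
    intro w
    simp only [LinearMap.comp_apply, LinearMap.coe_coe]
    induction w using FreeSemigroup.recOnMul with
    | ih1 y =>
      obtain ⟨j, i⟩ := y
      rw [← var_basis b]
      have h : (freeAction b γ).1 (var b j (b i)) =
        var b j (UniversalEnvelopingAlgebra.ι F γ * b i) := freeActionAux_var b γ j (b i)
      rw [h, evalAt_var, evalAt_var, map_mul, envAction_ι]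
      rfl
    | ih2 y v h1 h2 =>
      rw [mono_mul, (freeAction b γ).2, map_add, map_mul, map_mul, h1, h2, map_mul, (ρ γ).2]
  exact congrArg (fun g => g f) key

theorem freeAction_var (b : Module.Basis I F (UniversalEnvelopingAlgebra F L)) (γ : L) (j : ℕ)
    (h : UniversalEnvelopingAlgebra F L) :
    (freeAction b γ).1 (var b j h) = var b j (UniversalEnvelopingAlgebra.ι F γ * h) :=
  freeActionAux_var b γ j h

theorem envAction_freeAction_var (b : Module.Basis I F (UniversalEnvelopingAlgebra F L)) (j : ℕ)
    (g h : UniversalEnvelopingAlgebra F L) :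
    envAction (freeAction b) g (var b j h) = var b j (g * h) := by
  induction g using envelopingAlgebra_induction generalizing h with
  | algebraMap c => rw [AlgHom.commutes, ← Algebra.smul_def, map_smul]; rfl
  | ι γ => rw [envAction_ι, freeAction_var]
  | add g g' h1 h2 => rw [map_add, LinearMap.add_apply, h1, h2, add_mul, map_add]
  | mul g g' h1 h2 => rw [map_mul, Module.End.mul_apply, h2, h1, mul_assoc]

/-- A homomorphism that commutes with the action of `L` is an evaluation. -/
theorem comp_eq_evalAt (ρ : L →ₗ⁅F⁆ Der F A)
    (b : Module.Basis I F (UniversalEnvelopingAlgebra F L)) (φ : FreeDiffAlg F I →ₙₐ[F] A)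
    (hφ : ∀ (γ : L) f, φ ((freeAction b γ).1 f) = (ρ γ).1 (φ f)) :
    φ = evalAt ρ b fun j => φ (var b j 1) := by
  apply algHom_ext_var b
  intro j i
  rw [evalAt_var]
  -- Commutation with `L` propagates to all of `U(L)`, which `L` generates.
  have key : ∀ g h, φ (var b j (g * h)) = envAction ρ g (φ (var b j h)) := by
    intro g
    induction g using envelopingAlgebra_induction with
    | algebraMap c => intro h; rw [AlgHom.commutes, ← Algebra.smul_def, map_smul, map_smul]; rfl
    | ι γ => intro h; rw [envAction_ι, ← freeAction_var, hφ]
    | add g g' h1 h2 =>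
      intro h; rw [map_add, LinearMap.add_apply, ← h1, ← h2, add_mul, map_add, map_add]
    | mul g g' h1 h2 => intro h; rw [map_mul (envAction ρ), Module.End.mul_apply, ← h2, ← h1, mul_assoc]
  simpa using key (b i) 1

/-- For substitutions: an equivariant endomorphism followed by an evaluation is still equivariant,
hence is again an evaluation. -/
theorem isTLIdeal_diffId (ρ : L →ₗ⁅F⁆ Der F A)
    (b : Module.Basis I F (UniversalEnvelopingAlgebra F L)) : IsTLIdeal b (diffId ρ b) where
  mul_left g f hf a := by rw [map_mul, hf a, mul_zero]
  mul_right g f hf a := by rw [map_mul, hf a, zero_mul]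
  action γ f hf a := by rw [evalAt_freeAction, hf a, map_zero]
  substitution φ hφ f hf a := by
    have h := comp_eq_evalAt ρ b ((evalAt ρ b a).comp φ) (by
      intro γ f
      rw [NonUnitalAlgHom.comp_apply, hφ, evalAt_freeAction]
      rfl)
    exact (congrArg (fun g => g f) h).trans (hf _)

theorem isTLIdeal_tlSpan (b : Module.Basis I F (UniversalEnvelopingAlgebra F L))
    (S : Set (FreeDiffAlg F I)) : IsTLIdeal b (tlSpan b S) where
  mul_left g f hf := by
    rw [tlSpan, Submodule.mem_sInf] at hf ⊢
    exact fun Q hQ => hQ.1.mul_left g f (hf Q hQ)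
  mul_right g f hf := by
    rw [tlSpan, Submodule.mem_sInf] at hf ⊢
    exact fun Q hQ => hQ.1.mul_right g f (hf Q hQ)
  action γ f hf := by
    rw [tlSpan, Submodule.mem_sInf] at hf ⊢
    exact fun Q hQ => hQ.1.action γ f (hf Q hQ)
  substitution φ hφ f hf := by
    rw [tlSpan, Submodule.mem_sInf] at hf ⊢
    exact fun Q hQ => hQ.1.substitution φ hφ f (hf Q hQ)

theorem subset_tlSpan (b : Module.Basis I F (UniversalEnvelopingAlgebra F L))
    (S : Set (FreeDiffAlg F I)) : S ⊆ tlSpan b S := by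
  intro f hf
  rw [tlSpan, SetLike.mem_coe, Submodule.mem_sInf]
  exact fun Q hQ => hQ.2 hf

theorem tlSpan_le {b : Module.Basis I F (UniversalEnvelopingAlgebra F L)}
    {S : Set (FreeDiffAlg F I)} {Q : Submodule F (FreeDiffAlg F I)} (hQ : IsTLIdeal b Q)
    (hS : S ⊆ Q) : tlSpan b S ≤ Q :=
  sInf_le ⟨hQ, hS⟩

/-- Evaluations in the free algebra itself are substitutions. In this form one generator yields all
its consequences `x_j^h ↦ h(g_j)`. -/
theorem IsTLIdeal.evalAt_mem {b : Module.Basis I F (UniversalEnvelopingAlgebra F L)}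
    {Q : Submodule F (FreeDiffAlg F I)} (hQ : IsTLIdeal b Q) (g : ℕ → FreeDiffAlg F I)
    {f : FreeDiffAlg F I} (hf : f ∈ Q) : evalAt (freeAction b) b g f ∈ Q :=
  hQ.substitution _ (evalAt_freeAction (freeAction b) b g) f hf

end General

/-! ### Commutative unital quotients, in which polynomials can be evaluated -/

section UnitalQuotient

universe u v

variable {F : Type u} {A : Type v} [Field F] [NonUnitalRing A] [Module F A] [IsScalarTower F A A]
  [SMulCommClass F A A]

/-- A two-sided ideal of `A`, as an ideal of the unitization of `A`. -/
def unitizationIdeal (T : Submodule F A) (hl : ∀ g f, f ∈ T → g * f ∈ T) :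
    Ideal (Unitization F A) where
  carrier := {z | z.fst = 0 ∧ z.snd ∈ T}
  add_mem' := by
    rintro x y ⟨h1, h2⟩ ⟨h3, h4⟩
    exact ⟨by simp [h1, h3], T.add_mem h2 h4⟩
  zero_mem' := ⟨rfl, T.zero_mem⟩
  smul_mem' := by
    rintro c x ⟨h1, h2⟩
    refine ⟨by simp [h1], ?_⟩
    simp only [smul_eq_mul, Unitization.snd_mul, h1, zero_smul, add_zero]
    exact T.add_mem (T.smul_mem _ h2) (hl _ _ h2)

theorem isTwoSided_unitizationIdeal (T : Submodule F A) (hl : ∀ g f, f ∈ T → g * f ∈ T)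
    (hr : ∀ g f, f ∈ T → f * g ∈ T) : (unitizationIdeal T hl).IsTwoSided where
  mul_mem_of_left := by
    rintro x c ⟨h1, h2⟩
    refine ⟨by simp [h1], ?_⟩
    simp only [Unitization.snd_mul, h1, zero_smul, zero_add]
    exact T.add_mem (T.smul_mem _ h2) (hr _ _ h2)

theorem inr_mem_unitizationIdeal (T : Submodule F A) (hl : ∀ g f, f ∈ T → g * f ∈ T) (f : A) :
    (f : Unitization F A) ∈ unitizationIdeal T hl ↔ f ∈ T :=
  ⟨fun h => h.2, fun h => ⟨rfl, h⟩⟩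

/-- If `A` is commutative modulo an ideal `T`, then there is a homomorphism from `A` to a
commutative unital algebra with kernel `T`, through which every homomorphism to a unital algebra
that vanishes on `T` factors. -/
theorem exists_commRing_quotient (T : Submodule F A) (hl : ∀ g f, f ∈ T → g * f ∈ T)
    (hr : ∀ g f, f ∈ T → f * g ∈ T) (hcomm : ∀ f g : A, f * g - g * f ∈ T) :
    ∃ (R : Type (max u v)) (_ : CommRing R) (_ : Algebra F R) (π : A →ₙₐ[F] R),
      (∀ f, π f = 0 ↔ f ∈ T) ∧
      ∀ (B : Type u) [Ring B] [Algebra F B] (φ : A →ₙₐ[F] B), (∀ f ∈ T, φ f = 0) →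
        ∃ ψ : R →ₐ[F] B, ∀ f, ψ (π f) = φ f := by
  have := isTwoSided_unitizationIdeal T hl hr
  let _ : CommRing (Unitization F A ⧸ unitizationIdeal T hl) :=
    { Ideal.Quotient.ring (unitizationIdeal T hl) with
      mul_comm := by
        intro x y
        obtain ⟨x, rfl⟩ := Ideal.Quotient.mk_surjective x
        obtain ⟨y, rfl⟩ := Ideal.Quotient.mk_surjective y
        rw [← map_mul, ← map_mul, Ideal.Quotient.eq]
        refine ⟨by
          simp only [sub_eq_add_neg, Unitization.fst_add, Unitization.fst_neg, Unitization.fst_mul]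
          ring, ?_⟩
        -- Scalars are central, so they cancel from the commutator.
        have : (x * y - y * x).snd = x.snd * y.snd - y.snd * x.snd := by
          simp only [sub_eq_add_neg, Unitization.snd_add, Unitization.snd_neg, Unitization.snd_mul]
          abel
        rw [this]
        exact hcomm _ _ }
  refine ⟨Unitization F A ⧸ unitizationIdeal T hl, inferInstance,
    Ideal.Quotient.algebra F,
    ((Ideal.Quotient.mkₐ F (unitizationIdeal T hl)) :
      Unitization F A →ₙₐ[F] Unitization F A ⧸ unitizationIdeal T hl).comp
        (Unitization.inrNonUnitalAlgHom F A), ?_, ?_⟩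
  · intro f
    rw [← inr_mem_unitizationIdeal T hl]
    exact Ideal.Quotient.eq_zero_iff_mem
  · intro B _ _ φ hφ
    refine ⟨Ideal.Quotient.liftₐ (unitizationIdeal T hl) (Unitization.lift φ) ?_, ?_⟩
    · rintro z ⟨h1, h2⟩
      have : z = (z.snd : Unitization F A) := by ext <;> simp [h1]
      rw [this]
      simpa using hφ _ h2
    · intro f
      change Unitization.lift φ (f : Unitization F A) = φ f
      simp

end UnitalQuotient

/-! ### The normal form `p(X) + ∑ q_j(X) Y_j` and its uniqueness -/

section NormalForm

variable {F I R : Type*} [Field F] [CommRing R] [Algebra F R]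

/-- The linear combination `∑ q_j(X) Y_j`. -/
def linearPart (X Y : ℕ → R) : (ℕ →₀ MvPolynomial ℕ F) →ₗ[F] R :=
  Finsupp.lsum F fun j => (LinearMap.mulRight F (Y j)) ∘ₗ (MvPolynomial.aeval X).toLinearMap

theorem linearPart_single (X Y : ℕ → R) (j : ℕ) (p : MvPolynomial ℕ F) :
    linearPart X Y (Finsupp.single j p) = MvPolynomial.aeval X p * Y j := by
  simp [linearPart]

theorem linearPart_mul_aeval (X Y : ℕ → R) (q : ℕ →₀ MvPolynomial ℕ F) (p : MvPolynomial ℕ F) :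
    linearPart X Y (p • q) = linearPart X Y q * MvPolynomial.aeval X p := by
  induction q using Finsupp.induction_linear with
  | zero => simp
  | add f g hf hg => rw [smul_add, map_add, map_add, hf, hg, add_mul]
  | single j r =>
    rw [Finsupp.smul_single, linearPart_single, linearPart_single, smul_eq_mul, map_mul]
    ring

theorem linearPart_mul_eq_zero (X Y : ℕ → R) (hY : ∀ i j, Y i * Y j = 0)
    (q : ℕ →₀ MvPolynomial ℕ F) (k : ℕ) : linearPart X Y q * Y k = 0 := by
  induction q using Finsupp.induction_linear with
  | zero => simp
  | add f g hf hg => rw [map_add, add_mul, hf, hg, add_zero]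
  | single j r => rw [linearPart_single, mul_assoc, hY, mul_zero]

/-- If the generators go to combinations of the `X_j`, `Y_j` with `Y_i Y_j = 0`, then every value
has the form `p(X) + ∑ q_j(X) Y_j`. -/
theorem exists_normalForm (π : FreeDiffAlg F I →ₙₐ[F] R) (X Y : ℕ → R)
    (hY : ∀ i j, Y i * Y j = 0)
    (hπ : ∀ y : ℕ × I, ∃ α β : F, π (mono F (FreeSemigroup.of y)) = α • X y.1 + β • Y y.1)
    (f : FreeDiffAlg F I) :
    ∃ (p : MvPolynomial ℕ F) (q : ℕ →₀ MvPolynomial ℕ F), π f = MvPolynomial.aeval X p + linearPart X Y q := by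
  have hadd : ∀ f g : FreeDiffAlg F I, (∃ (p : MvPolynomial ℕ F) (q : ℕ →₀ MvPolynomial ℕ F), π f = MvPolynomial.aeval X p + linearPart X Y q) →
      (∃ (p : MvPolynomial ℕ F) (q : ℕ →₀ MvPolynomial ℕ F), π g = MvPolynomial.aeval X p + linearPart X Y q) →
      ∃ (p : MvPolynomial ℕ F) (q : ℕ →₀ MvPolynomial ℕ F), π (f + g) = MvPolynomial.aeval X p + linearPart X Y q := by
    rintro f g ⟨p, q, h⟩ ⟨p', q', h'⟩
    refine ⟨p + p', q + q', ?_⟩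
    rw [map_add, h, h', map_add, map_add]
    ring
  have hgen : ∀ y : ℕ × I, ∃ (p : MvPolynomial ℕ F) (q : ℕ →₀ MvPolynomial ℕ F),
      π (mono F (FreeSemigroup.of y)) = MvPolynomial.aeval X p + linearPart X Y q := by
    intro y
    obtain ⟨α, β, h⟩ := hπ y
    refine ⟨α • MvPolynomial.X y.1, Finsupp.single y.1 (MvPolynomial.C β), ?_⟩
    rw [h, linearPart_single, map_smul, MvPolynomial.aeval_X, MvPolynomial.aeval_C,
      ← Algebra.smul_def]
  have hmono : ∀ w, ∃ (p : MvPolynomial ℕ F) (q : ℕ →₀ MvPolynomial ℕ F), π (mono F w) = MvPolynomial.aeval X p + linearPart X Y q := by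
    intro w
    induction w using FreeSemigroup.recOnMul with
    | ih1 y => exact hgen y
    | ih2 y v _ h2 =>
      obtain ⟨p, q, h⟩ := h2
      obtain ⟨α, β, h'⟩ := hπ y
      -- Expansion of `(α X + β Y)(p(X) + ∑ q_j(X) Y_j)`, where the products of `Y` with the `Y_j`
      -- vanish.
      refine ⟨p * (α • MvPolynomial.X y.1),
        (α • MvPolynomial.X y.1 : MvPolynomial ℕ F) • q + Finsupp.single y.1 (β • p), ?_⟩
      rw [mono_mul, map_mul, h, h', map_add, linearPart_mul_aeval, linearPart_single, map_mul,
        map_smul, map_smul, MvPolynomial.aeval_X]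
      have h0 := linearPart_mul_eq_zero X Y hY q y.1
      simp only [add_mul, mul_add, smul_mul_assoc, mul_smul_comm, mul_comm (Y y.1), h0]
      simp only [mul_comm (X y.1), smul_zero]
      abel
  induction f using MonoidAlgebra.induction_linear with
  | zero => exact ⟨0, 0, by simp⟩
  | add f g hf hg => exact hadd f g hf hg
  | single w c =>
    obtain ⟨p, q, h⟩ := hmono w
    refine ⟨c • p, c • q, ?_⟩
    have : (MonoidAlgebra.single w c : FreeDiffAlg F I) = c • mono F w := by simp [mono]
    rw [this, map_smul, h, map_smul, map_smul, smul_add]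

/-- The scalar part is a homomorphism `C → F`. The `e₁₂` coefficient `d` is left unspecified because
it is never needed. -/
theorem exists_aeval_eq_mkC (ψ : R →ₐ[F] algC F) (X : ℕ → R) (α β : ℕ → F)
    (hX : ∀ j, ψ (X j) = mkC F (α j) (β j)) (p : MvPolynomial ℕ F) :
    ∃ d, ψ (MvPolynomial.aeval X p) = mkC F (MvPolynomial.eval α p) d := by
  induction p using MvPolynomial.induction_on with
  | C c =>
    refine ⟨0, ?_⟩
    rw [MvPolynomial.aeval_C, AlgHom.commutes, MvPolynomial.eval_C]
    apply Subtype.ext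
    ext i j
    fin_cases i <;> fin_cases j <;> simp [mkC, Matrix.single, Matrix.algebraMap_matrix_apply]
  | add p q hp hq =>
    obtain ⟨d, hd⟩ := hp
    obtain ⟨d', hd'⟩ := hq
    exact ⟨d + d', by rw [map_add, map_add, map_add, hd, hd', mkC_add]⟩
  | mul_X p j hp =>
    obtain ⟨d, hd⟩ := hp
    rw [map_mul, map_mul, map_mul, hd, MvPolynomial.aeval_X, hX, mkC_mul, MvPolynomial.eval_X]
    exact ⟨_, rfl⟩

theorem mkC_zero_zero : mkC F 0 0 = 0 := by
  apply Subtype.ext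
  simp [mkC]

theorem mkC_inj {α β α' β' : F} : mkC F α β = mkC F α' β' ↔ α = α' ∧ β = β' := by
  refine ⟨fun h => ?_, fun h => by rw [h.1, h.2]⟩
  have h0 := congrArg (fun M : algC F => M.1 0 0) h
  have h1 := congrArg (fun M : algC F => M.1 0 1) h
  constructor
  · simpa [mkC, Matrix.single] using h0
  · simpa [mkC, Matrix.single] using h1

/-- The `Y_j` go into `F e₁₂`, which has square zero, so only the scalar part of each `q_j(X)`
counts. -/
theorem map_linearPart_eq_mkC (ψ : R →ₐ[F] algC F) (X Y : ℕ → R) (α β : ℕ → F)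
    (hX : ∀ j, ψ (X j) = mkC F (α j) (β j)) (hY : ∀ j, ψ (Y j) = mkC F 0 (β j))
    (q : ℕ →₀ MvPolynomial ℕ F) :
    ψ (linearPart X Y q) = mkC F 0 (q.sum fun j p => MvPolynomial.eval α p * β j) := by
  induction q using Finsupp.induction_linear with
  | zero => simp [mkC_zero_zero]
  | add f g hf hg =>
    rw [map_add, map_add, hf, hg, mkC_add, add_zero, Finsupp.sum_add_index']
    · simp
    · intro j p p'; rw [map_add, add_mul]
  | single j p =>
    obtain ⟨d, hd⟩ := exists_aeval_eq_mkC ψ X α β hX p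
    rw [linearPart_single, map_mul, hd, hY, mkC_mul, Finsupp.sum_single_index (by simp)]
    simp

/-- A normal form that vanishes under all homomorphisms to `C` has zero coefficients. -/
theorem normalForm_eq_zero [Infinite F] (X Y : ℕ → R) {z : R}
    (hψ : ∀ α β : ℕ → F, ∃ ψ : R →ₐ[F] algC F, (∀ j, ψ (X j) = mkC F (α j) (β j)) ∧
      (∀ j, ψ (Y j) = mkC F 0 (β j)) ∧ ψ z = 0)
    {p : MvPolynomial ℕ F} {q : ℕ →₀ MvPolynomial ℕ F}
    (hz : z = MvPolynomial.aeval X p + linearPart X Y q) : z = 0 := by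
  -- The `e₁₂` coefficient also contains the unknown contribution of `p`, hence the condition `p =
  -- 0` in the second claim.
  have key : ∀ α β : ℕ → F, MvPolynomial.eval α p = 0 ∧
      (p = 0 → (q.sum fun j p => MvPolynomial.eval α p * β j) = 0) := by
    intro α β
    obtain ⟨ψ, hX, hY, h0⟩ := hψ α β
    obtain ⟨d, hd⟩ := exists_aeval_eq_mkC ψ X α β hX p
    rw [hz, map_add, map_linearPart_eq_mkC ψ X Y α β hX hY] at h0
    constructor
    · rw [hd, mkC_add, ← mkC_zero_zero, mkC_inj] at h0
      simpa using h0.1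
    · intro hp
      rw [hp, map_zero, map_zero, zero_add, ← mkC_zero_zero, mkC_inj] at h0
      exact h0.2
  have hp : p = 0 := MvPolynomial.funext fun α => by rw [(key α 0).1, map_zero]
  have hq : q = 0 := by
    ext1 j
    refine MvPolynomial.funext fun α => ?_
    -- The choice `β = Pi.single j 1` isolates `q_j(α)`.
    have h := (key α (Pi.single j 1)).2 hp
    rw [Finsupp.sum, Finset.sum_eq_single j] at h
    · simpa using h
    · intro i _ hij
      simp [hij]
    · intro hj
      simp [Finsupp.notMem_support_iff.1 hj]
  rw [hz, hp, hq, map_zero, map_zero, add_zero]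

end NormalForm

/-! ### Derivations of `C` and generators of its identities -/

section Identities

variable {F : Type*} [Field F]

theorem exists_eq_mkC (M : algC F) : ∃ α β : F, M = mkC F α β := by
  obtain ⟨_, α, β, rfl⟩ := M
  exact ⟨α, β, rfl⟩

theorem smul_mkC (c α β : F) : c • mkC F α β = mkC F (c * α) (c * β) := by
  apply Subtype.ext
  simp [mkC, mul_smul]

theorem mkC_one_zero : mkC F 1 0 = 1 := by
  apply Subtype.ext
  ext i j
  fin_cases i <;> fin_cases j <;> simp [mkC, Matrix.single]

theorem algC_mul_comm (M N : algC F) : M * N = N * M := by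
  obtain ⟨α, β, rfl⟩ := exists_eq_mkC M
  obtain ⟨α', β', rfl⟩ := exists_eq_mkC N
  rw [mkC_mul, mkC_mul, mkC_inj]
  constructor <;> ring

/-- The Leibniz rule on `1 · 1 = 1` gives `D(1) = 0`. On `e₁₂ · e₁₂ = 0` with `D(e₁₂) = r + s e₁₂`
it gives `2r = 0`, so `r = 0` in characteristic zero and `D = s ε`. -/
theorem exists_eq_smul_eps [CharZero F] (D : Der F (algC F)) : ∃ c : F, D = c • eps F := by
  obtain ⟨p, q, h1⟩ := exists_eq_mkC (D.1 (mkC F 1 0))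
  obtain ⟨r, s, h2⟩ := exists_eq_mkC (D.1 (mkC F 0 1))
  have e1 := D.2 (mkC F 1 0) (mkC F 1 0)
  have e2 := D.2 (mkC F 0 1) (mkC F 0 1)
  simp only [mkC_mul, h1, mkC_add, mul_one, mul_zero, zero_add, zero_mul, one_mul, add_zero,
    mkC_inj] at e1
  simp only [mkC_mul, h2, mkC_add, mul_one, mul_zero, zero_add, zero_mul, one_mul, add_zero,
    mkC_zero_zero, map_zero] at e2
  rw [← mkC_zero_zero, mkC_inj] at e2
  have hp : p = 0 := by linear_combination -e1.1
  have hq : q = 0 := by linear_combination -e1.2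
  have hr : r = 0 := by
    have : (2 : F) * r = 0 := by linear_combination -e2.2
    simpa using this
  refine ⟨s, Subtype.ext (LinearMap.ext fun M => ?_)⟩
  obtain ⟨α, β, rfl⟩ := exists_eq_mkC M
  have : mkC F α β = α • mkC F 1 0 + β • mkC F 0 1 := by
    rw [smul_mkC, smul_mkC, mkC_add]
    simp
  change D.1 (mkC F α β) = s • epsLin F (mkC F α β)
  rw [epsLin_mkC, this, map_add, map_smul, map_smul, h1, h2, smul_mkC, smul_mkC, smul_mkC, mkC_add,
    hp, hq, hr, mkC_inj]
  constructor <;> ring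

variable {L I : Type*} [LieRing L] [LieAlgebra F L]

theorem envAction_eps_mkC {ρ : L →ₗ⁅F⁆ Der F (algC F)} {e : L} (he : ρ e = eps F) (α β : F) :
    envAction ρ (UniversalEnvelopingAlgebra.ι F e) (mkC F α β) = mkC F 0 β := by
  rw [envAction_ι, he]
  exact epsLin_mkC F α β

theorem gensC_subset_diffId {ρ : L →ₗ⁅F⁆ Der F (algC F)} {e : L} (he : ρ e = eps F)
    (b : Module.Basis I F (UniversalEnvelopingAlgebra F L)) :
    gensC b e ⊆ (diffId ρ b : Set (FreeDiffAlg F I)) := by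
  rintro f (rfl | rfl | rfl) a
  · rw [map_sub, map_mul, map_mul, algC_mul_comm, sub_self]
  · rw [map_mul, evalAt_var, evalAt_var]
    obtain ⟨α, β, h⟩ := exists_eq_mkC (a 0)
    obtain ⟨α', β', h'⟩ := exists_eq_mkC (a 1)
    rw [h, h', envAction_eps_mkC he, envAction_eps_mkC he, mkC_mul, ← mkC_zero_zero]
    simp
  · rw [map_sub, evalAt_var, evalAt_var]
    obtain ⟨α, β, h⟩ := exists_eq_mkC (a 0)
    rw [h, map_pow, pow_two, Module.End.mul_apply, envAction_eps_mkC he, envAction_eps_mkC he,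
      sub_self]

theorem kernel_subset_diffId {A : Type*} [NonUnitalRing A] [Module F A] [IsScalarTower F A A]
    [SMulCommClass F A A] (ρ : L →ₗ⁅F⁆ Der F A)
    (b : Module.Basis I F (UniversalEnvelopingAlgebra F L)) :
    {f | ∃ γ : L, ρ γ = 0 ∧ f = var b 0 (UniversalEnvelopingAlgebra.ι F γ)} ⊆
      (diffId ρ b : Set (FreeDiffAlg F I)) := by
  rintro f ⟨γ, hγ, rfl⟩ a
  rw [evalAt_var, envAction_ι, hγ]
  rfl

/-- Modulo the generators, every variable `x^h` is a combination of `x` and `x^ε`. -/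
theorem exists_var_congr [CharZero F] {ρ : L →ₗ⁅F⁆ Der F (algC F)} {e : L} (he : ρ e = eps F)
    {b : Module.Basis I F (UniversalEnvelopingAlgebra F L)} {T : Submodule F (FreeDiffAlg F I)}
    (hT : IsTLIdeal b T) (hg : gensC b e ⊆ (T : Set (FreeDiffAlg F I)))
    (hk : ∀ γ : L, ρ γ = 0 → var b 0 (UniversalEnvelopingAlgebra.ι F γ) ∈ T)
    (h : UniversalEnvelopingAlgebra F L) :
    ∃ α β : F, ∀ (j : ℕ) (g : UniversalEnvelopingAlgebra F L),
      var b j (h * g) - α • var b j g - β • var b j (UniversalEnvelopingAlgebra.ι F e * g) ∈ T := by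
  -- The right factor `g` lets the case of a product `h h'` use the hypothesis for `h` with `h' * g`
  -- in place of `g`.
  induction h using envelopingAlgebra_induction with
  | algebraMap c =>
    refine ⟨c, 0, fun j g => ?_⟩
    rw [← Algebra.smul_def, map_smul]
    simp
  | ι γ =>
    obtain ⟨c, hc⟩ := exists_eq_smul_eps (ρ γ)
    refine ⟨0, c, fun j g => ?_⟩
    -- `γ - c e` lies in `ker ρ`; here `x_j^g` is substituted into the corresponding trivial
    -- identity.
    have h0 := hT.evalAt_mem (fun _ => var b j g) (hk (γ - c • e) (by
      rw [map_sub, map_smul, hc, he, sub_self]))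
    rw [evalAt_var, envAction_freeAction_var, map_sub, map_smul, sub_mul, map_sub, smul_mul_assoc,
      map_smul] at h0
    simpa using h0
  | add h h' i i' =>
    obtain ⟨α, β, i⟩ := i
    obtain ⟨α', β', i'⟩ := i'
    refine ⟨α + α', β + β', fun j g => ?_⟩
    have h0 := T.add_mem (i j g) (i' j g)
    rw [add_mul, map_add]
    convert h0 using 1
    module
  | mul h h' i i' =>
    obtain ⟨α, β, i⟩ := i
    obtain ⟨α', β', i'⟩ := i'
    -- The coefficients of `(α + β ε)(α' + β' ε)` after `ε² = ε`; the latter enters through `h4`.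
    refine ⟨α * α', α * β' + β * (α' + β'), fun j g => ?_⟩
    have h1 := i j (h' * g)
    have h2 := i' j g
    have h3 := hT.action e _ h2
    have h4 := hT.evalAt_mem (fun _ => var b j g) (hg (by right; right; rfl))
    rw [map_sub, map_sub, map_smul, map_smul, freeAction_var, freeAction_var,
      freeAction_var] at h3
    rw [map_sub, evalAt_var, evalAt_var, envAction_freeAction_var, envAction_freeAction_var,
      pow_two, mul_assoc] at h4
    have h5 := T.add_mem (T.add_mem h1 (T.smul_mem α h2))
      (T.add_mem (T.smul_mem β h3) (T.smul_mem (β * β') h4))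
    rw [mul_assoc h h' g]
    convert h5 using 1
    module

/-- As `T` consists of identities, evaluations in `C` factor through the quotient by `T`, where
normal forms exist. An identity then has a normal form that all these evaluations kill. Leaving `T`
arbitrary covers both the injective and the general case. -/
theorem diffId_le_of_gensC [CharZero F] {ρ : L →ₗ⁅F⁆ Der F (algC F)} {e : L} (he : ρ e = eps F)
    {b : Module.Basis I F (UniversalEnvelopingAlgebra F L)} {T : Submodule F (FreeDiffAlg F I)}
    (hT : IsTLIdeal b T) (hg : gensC b e ⊆ (T : Set (FreeDiffAlg F I)))
    (hk : ∀ γ : L, ρ γ = 0 → var b 0 (UniversalEnvelopingAlgebra.ι F γ) ∈ T)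
    (hId : T ≤ diffId ρ b) : diffId ρ b ≤ T := by
  have hcomm : ∀ f g : FreeDiffAlg F I, f * g - g * f ∈ T := by
    intro f g
    have h := hT.evalAt_mem (fun j => if j = 0 then f else g) (hg (by left; rfl))
    rw [map_sub, map_mul, map_mul, evalAt_var, evalAt_var, map_one] at h
    simpa using h
  have hYY : ∀ i j, var b i (UniversalEnvelopingAlgebra.ι F e) *
      var b j (UniversalEnvelopingAlgebra.ι F e) ∈ T := by
    intro i j
    have h := hT.evalAt_mem (fun k => if k = 0 then var b i 1 else var b j 1)
      (hg (by right; left; rfl))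
    rw [map_mul, evalAt_var, evalAt_var] at h
    simpa [envAction_freeAction_var] using h
  obtain ⟨R, _, _, π, hπ, hlift⟩ := exists_commRing_quotient T hT.mul_left hT.mul_right hcomm
  intro f hf
  rw [← hπ]
  obtain ⟨p, q, hpq⟩ := exists_normalForm π (fun j => π (var b j 1))
    (fun j => π (var b j (UniversalEnvelopingAlgebra.ι F e)))
    (fun i j => by rw [← map_mul, hπ]; exact hYY i j)
    (by
      rintro ⟨j, i⟩
      obtain ⟨α, β, h⟩ := exists_var_congr he hT hg hk (b i)
      refine ⟨α, β, ?_⟩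
      have h0 := (hπ _).2 (h j 1)
      rw [map_sub, map_sub, map_smul, map_smul, mul_one, mul_one, var_basis] at h0
      rw [← sub_eq_zero, ← h0]
      abel) f
  refine normalForm_eq_zero _ _ (fun α β => ?_) hpq
  obtain ⟨ψ, hψ⟩ := hlift (algC F) (evalAt ρ b fun j => mkC F (α j) (β j))
    (fun g hg' => hId hg' _)
  refine ⟨ψ, fun j => ?_, fun j => ?_, ?_⟩
  · rw [hψ, evalAt_var, map_one]; rfl
  · rw [hψ, evalAt_var, envAction_eps_mkC he]
  · rw [hψ]; exact hf _

theorem diffId_eq_tlSpan [CharZero F] {ρ : L →ₗ⁅F⁆ Der F (algC F)} {e : L} (he : ρ e = eps F)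
    (b : Module.Basis I F (UniversalEnvelopingAlgebra F L)) :
    diffId ρ b = tlSpan b (gensC b e ∪
      {f | ∃ γ : L, ρ γ = 0 ∧ f = var b 0 (UniversalEnvelopingAlgebra.ι F γ)}) := by
  have hle := tlSpan_le (isTLIdeal_diffId ρ b)
    (Set.union_subset (gensC_subset_diffId he b) (kernel_subset_diffId ρ b))
  have hsub := Set.union_subset_iff.1 (subset_tlSpan b (gensC b e ∪
    {f | ∃ γ : L, ρ γ = 0 ∧ f = var b 0 (UniversalEnvelopingAlgebra.ι F γ)}))
  exact le_antisymm (diffId_le_of_gensC he (isTLIdeal_tlSpan b _) hsub.1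
    (fun γ hγ => hsub.2 ⟨γ, hγ, rfl⟩) hle) hle

theorem diffId_eq_tlSpan_of_injective [CharZero F] {ρ : L →ₗ⁅F⁆ Der F (algC F)} {e : L}
    (he : ρ e = eps F) (b : Module.Basis I F (UniversalEnvelopingAlgebra F L))
    (hρ : Function.Injective ρ) : diffId ρ b = tlSpan b (gensC b e) := by
  have hle := tlSpan_le (isTLIdeal_diffId ρ b) (gensC_subset_diffId he b)
  refine le_antisymm (diffId_le_of_gensC he (isTLIdeal_tlSpan b _) (subset_tlSpan b _)
    (fun γ hγ => ?_) hle) hle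
  rw [(map_eq_zero_iff ρ hρ).1 hγ, map_zero, map_zero]
  exact Submodule.zero_mem _

end Identities

/-! ### Multilinear polynomials on `C`: codimensions and cocharacters -/

section MultilinearComponents

variable {F L I : Type*} [Field F] [LieRing L] [LieAlgebra F L]

/-- The enveloping algebra acts on `C` by diagonal operators. -/
theorem exists_envAction_diagonal [CharZero F] (ρ : L →ₗ⁅F⁆ Der F (algC F)) :
    ∃ α δ : UniversalEnvelopingAlgebra F L →ₗ[F] F, ∀ h x y,
      envAction ρ h (mkC F x y) = mkC F (α h * x) (δ h * y) := by
  have hex : ∀ h : UniversalEnvelopingAlgebra F L, ∃ p q : F, ∀ x y,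
      envAction ρ h (mkC F x y) = mkC F (p * x) (q * y) := by
    intro h
    induction h using envelopingAlgebra_induction with
    | algebraMap c =>
      refine ⟨c, c, fun x y => ?_⟩
      rw [AlgHom.commutes, ← smul_mkC]
      rfl
    | ι γ =>
      obtain ⟨c, hc⟩ := exists_eq_smul_eps (ρ γ)
      refine ⟨0, c, fun x y => ?_⟩
      rw [envAction_ι, hc]
      change c • epsLin F (mkC F x y) = _
      rw [epsLin_mkC, smul_mkC, mul_zero, zero_mul]
    | add g h hg hh =>
      obtain ⟨p, q, hg⟩ := hg
      obtain ⟨p', q', hh⟩ := hh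
      refine ⟨p + p', q + q', fun x y => ?_⟩
      rw [map_add, LinearMap.add_apply, hg, hh, mkC_add, add_mul, add_mul]
    | mul g h hg hh =>
      obtain ⟨p, q, hg⟩ := hg
      obtain ⟨p', q', hh⟩ := hh
      refine ⟨p * p', q * q', fun x y => ?_⟩
      rw [map_mul, Module.End.mul_apply, hh, hg, mul_assoc, mul_assoc]
  choose p q hpq using hex
  -- The two eigenvalues are read off from the value at `mkC F 1 1`, hence depend linearly on `h`.
  have hadd : ∀ g h, p (g + h) = p g + p h ∧ q (g + h) = q g + q h := by
    intro g h
    have := hpq (g + h) 1 1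
    rw [map_add, LinearMap.add_apply, hpq, hpq, mkC_add, mkC_inj] at this
    simp only [mul_one] at this
    exact ⟨this.1.symm, this.2.symm⟩
  have hsmul : ∀ (c : F) h, p (c • h) = c * p h ∧ q (c • h) = c * q h := by
    intro c h
    have := hpq (c • h) 1 1
    rw [map_smul, LinearMap.smul_apply, hpq, smul_mkC, mkC_inj] at this
    simp only [mul_one] at this
    exact ⟨this.1.symm, this.2.symm⟩
  exact ⟨⟨⟨p, fun g h => (hadd g h).1⟩, fun c h => (hsmul c h).1⟩,
    ⟨⟨q, fun g h => (hadd g h).2⟩, fun c h => (hsmul c h).2⟩, hpq⟩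

theorem lift_eq_prod {X B : Type*} [Monoid B] (g : X → B) (w : FreeSemigroup X) :
    FreeSemigroup.lift g w = ((w.head :: w.tail).map g).prod := by
  induction w using FreeSemigroup.recOnMul with
  | ih1 y => simp
  | ih2 y v h1 h2 =>
    rw [map_mul, h1, h2, FreeSemigroup.head_mul, FreeSemigroup.tail_mul]
    simp

/-- Because `e₁₂² = 0`, exactly one factor contributes its `e₁₂` part, as in the product rule. -/
theorem prod_ofFn_mkC {n : ℕ} (u v : Fin n → F) :
    (List.ofFn fun k => mkC F (u k) (v k)).prod =
      mkC F (∏ k, u k) (∑ j, ∏ k, if k = j then v k else u k) := by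
  induction n with
  | zero => simp [mkC_one_zero]
  | succ n ih =>
    rw [List.ofFn_succ, List.prod_cons, ih, mkC_mul, mkC_inj]
    refine ⟨(Fin.prod_univ_succ _).symm, ?_⟩
    simp only [Fin.sum_univ_succ, Fin.prod_univ_succ, Finset.mul_sum]
    simp [Fin.succ_ne_zero, (Fin.succ_ne_zero _).symm, add_comm]

/-- The value of a multilinear monomial on elements of `C`. -/
theorem evalAt_multilinear_mono {ρ : L →ₗ⁅F⁆ Der F (algC F)}
    {α δ : UniversalEnvelopingAlgebra F L → F}
    (hαδ : ∀ h x y, envAction ρ h (mkC F x y) = mkC F (α h * x) (δ h * y))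
    (b : Module.Basis I F (UniversalEnvelopingAlgebra F L)) {n : ℕ} (σ : Perm (Fin n))
    (h : Fin n → I) (w : FreeSemigroup (ℕ × I))
    (hw : w.head :: w.tail = List.ofFn (fun k => ((σ k : ℕ), h k))) (x y : ℕ → F) :
    evalAt ρ b (fun k => mkC F (x k) (y k)) (mono F w) =
      mkC F ((∏ k, α (b (h k))) * ∏ k : Fin n, x k)
        (∑ j, (∏ k, if σ k = j then δ (b (h k)) else α (b (h k))) *
          ∏ k : Fin n, if k = j then y k else x k) := by
  rw [evalAt, freeLift_mono, lift_eq_prod, hw, List.map_ofFn]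
  simp only [Function.comp_def, hαδ]
  rw [prod_ofFn_mkC, mkC_inj]
  constructor
  · rw [Finset.prod_mul_distrib, Equiv.prod_comp σ fun k : Fin n => x k]
  -- The sum is reindexed from positions in the word to variables: position `k` holds the variable
  -- `σ k`.
  · symm
    rw [← Equiv.sum_comp σ]
    refine Finset.sum_congr rfl fun j _ => ?_
    rw [← Equiv.prod_comp σ (fun k : Fin n => if k = σ j then y k else x k),
      ← Finset.prod_mul_distrib]
    refine Finset.prod_congr rfl fun k _ => ?_
    by_cases hk : k = j <;> simp [hk]

/-- The components of a multilinear polynomial: the values at `(1, …, 1)` and at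
`(1, …, e₁₂, …, 1)`. -/
def components (ρ : L →ₗ⁅F⁆ Der F (algC F))
    (b : Module.Basis I F (UniversalEnvelopingAlgebra F L)) (n : ℕ) :
    FreeDiffAlg F I →ₗ[F] F × (Fin n → F) where
  toFun f := ((evalAt ρ b (fun _ => mkC F 1 0) f).1 0 0, fun j =>
    (evalAt ρ b (fun k => mkC F (if k = (j : ℕ) then 0 else 1) (if k = (j : ℕ) then 1 else 0))
      f).1 0 1)
  map_add' f g := by
    ext <;> simp
  map_smul' c f := by
    ext <;> simp

/-- With `e₁₂` in place `j` the scalar part there is `0`, so every summand other than the `j`-th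
contains a zero factor. -/
theorem components_eq {ρ : L →ₗ⁅F⁆ Der F (algC F)}
    {b : Module.Basis I F (UniversalEnvelopingAlgebra F L)} {n : ℕ} {f : FreeDiffAlg F I}
    {c : F} {d : Fin n → F}
    (hf : ∀ x y : ℕ → F, evalAt ρ b (fun k => mkC F (x k) (y k)) f =
      mkC F (c * ∏ k : Fin n, x k) (∑ j, d j * ∏ k : Fin n, if k = j then y k else x k)) :
    components ρ b n f = (c, d) := by
  ext j
  · change (evalAt ρ b (fun _ => mkC F 1 0) f).1 0 0 = c
    rw [hf (fun _ => 1) (fun _ => 0)]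
    simp [mkC, Matrix.single]
  · change (evalAt ρ b (fun k => mkC F (if k = (j : ℕ) then 0 else 1)
      (if k = (j : ℕ) then 1 else 0)) f).1 0 1 = d j
    rw [hf, mkC_entry, Finset.sum_eq_single j]
    · rw [Finset.prod_eq_one, mul_one]
      intro k _
      by_cases hk : k = j
      · simp [hk]
      · have : (k : ℕ) ≠ j := fun h => hk (Fin.ext h)
        simp [hk, this]
    · intro i _ hij
      have : (i : ℕ) ≠ j := fun h => hij (Fin.ext h)
      rw [Finset.prod_eq_zero (Finset.mem_univ i), mul_zero]
      simp [this]
    · simp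

theorem exists_evalAt_multilinear [CharZero F] (ρ : L →ₗ⁅F⁆ Der F (algC F))
    (b : Module.Basis I F (UniversalEnvelopingAlgebra F L)) {n : ℕ} {f : FreeDiffAlg F I}
    (hf : f ∈ multilinear F I n) :
    ∃ (c : F) (d : Fin n → F), ∀ x y : ℕ → F, evalAt ρ b (fun k => mkC F (x k) (y k)) f =
      mkC F (c * ∏ k : Fin n, x k) (∑ j, d j * ∏ k : Fin n, if k = j then y k else x k) := by
  obtain ⟨α, δ, hαδ⟩ := exists_envAction_diagonal ρ
  induction hf using Submodule.span_induction with
  | mem f hf =>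
    obtain ⟨σ, h, w, hw, rfl⟩ := hf
    exact ⟨_, _, evalAt_multilinear_mono hαδ b σ h w hw⟩
  | zero => exact ⟨0, 0, fun x y => by simp [mkC_zero_zero]⟩
  | add f g _ _ hf hg =>
    obtain ⟨c, d, hf⟩ := hf
    obtain ⟨c', d', hg⟩ := hg
    refine ⟨c + c', d + d', fun x y => ?_⟩
    rw [map_add, hf, hg, mkC_add, add_mul, ← Finset.sum_add_distrib]
    simp only [Pi.add_apply, add_mul]
  | smul s f _ hf =>
    obtain ⟨c, d, hf⟩ := hf
    refine ⟨s * c, s • d, fun x y => ?_⟩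
    rw [map_smul, hf, smul_mkC, Finset.mul_sum]
    simp only [Pi.smul_apply, smul_eq_mul, mul_assoc]

theorem mem_diffId_iff_components [CharZero F] (ρ : L →ₗ⁅F⁆ Der F (algC F))
    (b : Module.Basis I F (UniversalEnvelopingAlgebra F L)) {n : ℕ} {f : FreeDiffAlg F I}
    (hf : f ∈ multilinear F I n) : f ∈ diffId ρ b ↔ components ρ b n f = 0 := by
  constructor
  · intro h
    ext j
    · exact congrArg (fun M : algC F => M.1 0 0) (h _)
    · exact congrArg (fun M : algC F => M.1 0 1) (h _)
  · intro h a
    obtain ⟨c, d, hcd⟩ := exists_evalAt_multilinear ρ b hf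
    rw [components_eq hcd, Prod.mk_eq_zero] at h
    choose x y hxy using fun k => exists_eq_mkC (a k)
    rw [show a = fun k => mkC F (x k) (y k) from funext hxy, hcd, h.1, h.2]
    simp [mkC_zero_zero]

/-- The basis of `U(L)` need not contain `1` or `e`, so preimages are not simply monomials. Instead,
a functional `φ` that kills the image gives a multilinear form on `U(L)ⁿ` which vanishes on basis
tuples, hence everywhere. Its values on tuples made of `1` and `ι e` force `φ = 0`. -/
theorem components_surjective [CharZero F] {ρ : L →ₗ⁅F⁆ Der F (algC F)} {e : L}
    (he : ρ e = eps F) (b : Module.Basis I F (UniversalEnvelopingAlgebra F L)) {n : ℕ}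
    (hn : 1 ≤ n) :
    LinearMap.range ((components ρ b n).domRestrict (multilinear F I n)) = ⊤ := by
  by_contra hne
  obtain ⟨φ, hφ0, hφ⟩ := Submodule.exists_le_ker_of_lt_top _ (lt_top_iff_ne_top.2 hne)
  obtain ⟨α, δ, hαδ⟩ := exists_envAction_diagonal ρ
  have hα1 : α 1 = 1 := by
    have := hαδ 1 1 1
    rw [map_one, Module.End.one_apply, mkC_inj] at this
    simpa using this.1.symm
  obtain ⟨u, hαu, hδu⟩ : ∃ u, α u = 0 ∧ δ u = 1 := by
    have := hαδ (UniversalEnvelopingAlgebra.ι F e) 1 1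
    rw [envAction_eps_mkC he, mkC_inj, mul_one, mul_one] at this
    exact ⟨_, this.1.symm, this.2.symm⟩
  have hφeq : ∀ c d, φ (c, d) = c * φ (1, 0) + ∑ j, d j * φ (0, Pi.single j 1) := by
    intro c d
    have : ((c, d) : F × (Fin n → F)) =
        c • (1, 0) + ∑ j, d j • ((0, Pi.single j 1) : F × (Fin n → F)) := by
      ext j
      · simp [Prod.fst_sum]
      · simp [Prod.snd_sum, Finset.sum_apply, Pi.single_apply]
    rw [this, map_add, map_sum, map_smul]
    simp only [map_smul, smul_eq_mul]
  -- `G h` is `φ` of the components that `x_0^{h_0} ⋯ x_{n-1}^{h_{n-1}}` has for arbitrary `h_k ∈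
  -- U(L)`.
  let G : MultilinearMap F (fun _ : Fin n => UniversalEnvelopingAlgebra F L) F :=
    φ (1, 0) • (MultilinearMap.mkPiAlgebra F (Fin n) F).compLinearMap (fun _ => α) +
      ∑ j, φ (0, Pi.single j 1) • (MultilinearMap.mkPiAlgebra F (Fin n) F).compLinearMap
        (fun k => if k = j then δ else α)
  have hG : ∀ h, G h = φ (∏ k, α (h k), fun j => ∏ k, if k = j then δ (h k) else α (h k)) := by
    intro h
    rw [hφeq]
    simp only [G, _root_.add_apply, _root_.smul_apply, _root_.sum_apply,
      MultilinearMap.compLinearMap_apply, MultilinearMap.mkPiAlgebra_apply, smul_eq_mul]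
    congr 1
    · ring
    · refine Finset.sum_congr rfl fun j _ => ?_
      rw [mul_comm]
      congr 1
      refine Finset.prod_congr rfl fun k _ => ?_
      split_ifs <;> rfl
  have hG0 : G = 0 := by
    apply Module.Basis.ext_multilinear (fun _ => b)
    intro h
    rw [hG]
    -- Words are nonempty, so `1 ≤ n` is needed here.
    obtain ⟨m, rfl⟩ : ∃ m, n = m + 1 := ⟨n - 1, by omega⟩
    let w : FreeSemigroup (ℕ × I) := ⟨(0, h 0), List.ofFn fun k : Fin m => ((k.succ : ℕ), h k.succ)⟩
    have hw : w.head :: w.tail =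
        List.ofFn (fun k => (((1 : Perm (Fin (m + 1))) k : ℕ), h k)) := by
      rw [List.ofFn_succ]
      rfl
    have hmem : mono F w ∈ multilinear F I (m + 1) := Submodule.subset_span ⟨1, h, w, hw, rfl⟩
    have := hφ ⟨⟨mono F w, hmem⟩, rfl⟩
    rw [LinearMap.mem_ker, LinearMap.domRestrict_apply,
      components_eq (evalAt_multilinear_mono hαδ b 1 h w hw)] at this
    exact this
  have hd : ∀ j, φ (0, Pi.single j 1) = 0 := by
    intro j
    -- As `α u = 0` and `δ u = 1`, only the `j`-th `e₁₂` component survives.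
    have h := hG fun k => if k = j then u else 1
    rw [hG0, _root_.zero_apply] at h
    refine Eq.trans ?_ h.symm
    congr 1
    refine Prod.ext (Finset.prod_eq_zero (Finset.mem_univ j) (by simp [hαu])).symm ?_
    funext i
    change (Pi.single j 1 : Fin n → F) i =
      ∏ k, if k = i then δ (if k = j then u else 1) else α (if k = j then u else 1)
    by_cases hij : i = j
    · subst hij
      rw [Pi.single_eq_same, Finset.prod_eq_one]
      intro k _
      by_cases hk : k = i <;> simp [hk, hδu, hα1]
    · rw [Pi.single_eq_of_ne hij, Finset.prod_eq_zero (Finset.mem_univ j)]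
      simp [Ne.symm hij, hαu]
  have hc : φ (1, 0) = 0 := by
    -- The components here are `(1, (1, …, 1))`, and `φ` already vanishes on the second factor.
    have h := hG fun _ => 1
    rw [hG0, _root_.zero_apply, hφeq] at h
    simp only [hd, hα1] at h
    simpa using h.symm
  apply hφ0
  apply LinearMap.ext
  rintro ⟨c, d⟩
  rw [hφeq, hc]
  simp [hd]

/-- The module `P_n^L(C)` is the sum of the trivial module and the permutation module `Fⁿ`. -/
def componentsEquiv [CharZero F] {ρ : L →ₗ⁅F⁆ Der F (algC F)} {e : L}
    (he : ρ e = eps F) (b : Module.Basis I F (UniversalEnvelopingAlgebra F L)) {n : ℕ}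
    (hn : 1 ≤ n) : (multilinear F I n ⧸ multilinearId ρ b n) ≃ₗ[F] F × (Fin n → F) :=
  (Submodule.quotEquivOfEq _ _ (by
    ext f
    rw [LinearMap.mem_ker, LinearMap.domRestrict_apply, ← mem_diffId_iff_components ρ b f.2]
    rfl)).trans
      (((components ρ b n).domRestrict (multilinear F I n)).quotKerEquivOfSurjective
        (LinearMap.range_eq_top.1 (components_surjective he b hn)))

theorem componentsEquiv_mk [CharZero F] {ρ : L →ₗ⁅F⁆ Der F (algC F)} {e : L}
    (he : ρ e = eps F) (b : Module.Basis I F (UniversalEnvelopingAlgebra F L)) {n : ℕ}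
    (hn : 1 ≤ n) (f : multilinear F I n) :
    componentsEquiv he b hn (Submodule.Quotient.mk f) = components ρ b n f :=
  rfl

theorem codim_eq [CharZero F] {ρ : L →ₗ⁅F⁆ Der F (algC F)} {e : L}
    (he : ρ e = eps F) (b : Module.Basis I F (UniversalEnvelopingAlgebra F L)) {n : ℕ}
    (hn : 1 ≤ n) : codim ρ b n = ((n + 1 : ℕ) : Cardinal) := by
  have := Module.Finite.equiv (componentsEquiv he b hn).symm
  rw [codim, ← Module.finrank_eq_rank, (componentsEquiv he b hn).finrank_eq]
  simp [add_comm]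

/-- Renaming variables by `σ` turns the substitution with `e₁₂` in place `j` into the one with `e₁₂`
in place `σ⁻¹ j`, and fixes the constant substitution. -/
theorem components_permAction (ρ : L →ₗ⁅F⁆ Der F (algC F))
    (b : Module.Basis I F (UniversalEnvelopingAlgebra F L)) {n : ℕ} (σ : Perm (Fin n))
    (f : FreeDiffAlg F I) :
    components ρ b n (permAction F I n σ f) =
      LinearMap.prodMap LinearMap.id (LinearMap.funLeft F F (σ⁻¹ : Perm (Fin n)))
        (components ρ b n f) := by
  have hσ : ∀ (k : ℕ) (j : Fin n), permNat n σ k = j ↔ k = (σ⁻¹ j : Fin n) := by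
    intro k j
    rw [← (permNat n σ).injective.eq_iff (b := ((σ⁻¹ j : Fin n) : ℕ)), permNat_apply]
    simp
  ext j
  · exact congrArg (fun M : algC F => M.1 0 0) (evalAt_rename ρ b _ (permNat n σ) f)
  · refine (congrArg (fun M : algC F => M.1 0 1) (evalAt_rename ρ b _ (permNat n σ) f)).trans ?_
    simp only [hσ]
    rfl

/-- The character of the permutation module `Fⁿ`. -/
def permTrace (F : Type*) [Field F] {n : ℕ} (σ : Perm (Fin n)) : F :=
  LinearMap.trace F (Fin n → F) (LinearMap.funLeft F F (σ⁻¹ : Perm (Fin n)))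

theorem cocharacter_eq [CharZero F] {ρ : L →ₗ⁅F⁆ Der F (algC F)} {e : L}
    (he : ρ e = eps F) (b : Module.Basis I F (UniversalEnvelopingAlgebra F L)) {n : ℕ}
    (hn : 1 ≤ n) (σ : Perm (Fin n)) : cocharacter ρ b n σ = 1 + permTrace F σ := by
  rw [cocharacter, Representation.character, ← LinearMap.trace_conj' _ (componentsEquiv he b hn)]
  have : (componentsEquiv he b hn).conj (cocharModule ρ b n σ) =
      LinearMap.prodMap LinearMap.id (LinearMap.funLeft F F (σ⁻¹ : Perm (Fin n))) := by
    apply LinearMap.ext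
    intro v
    obtain ⟨v, rfl⟩ := (componentsEquiv he b hn).surjective v
    obtain ⟨f, rfl⟩ := Submodule.Quotient.mk_surjective _ v
    rw [LinearEquiv.conj_apply_apply, LinearEquiv.symm_apply_apply, componentsEquiv_mk,
      ← components_permAction]
    rfl
  rw [this, LinearMap.trace_prodMap', LinearMap.trace_id, Module.finrank_self, Nat.cast_one]
  rfl

end MultilinearComponents

/-! ### The Specht characters of `(n)` and `(n-1,1)` -/

section SpechtCharacters

variable (F : Type*) [Field F]

theorem tabloidRep_single {n : ℕ} (σ : Perm (Fin n)) (r : Fin n → ℕ) (c : F) :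
    tabloidRep F n σ (Finsupp.single r c) = Finsupp.single (r ∘ ⇑σ⁻¹) c := by
  simp [tabloidRep, Finsupp.mapDomain_single]

theorem mem_rowShape {n : ℕ} {c : ℕ × ℕ} : c ∈ (rowShape n).cells ↔ c.1 = 0 ∧ c.2 < n := by
  rw [YoungDiagram.mem_cells, rowShape, YoungDiagram.mem_ofRowLens]
  obtain ⟨i, j⟩ := c
  constructor
  · rintro ⟨h, h'⟩
    obtain rfl : i = 0 := by simpa using h
    exact ⟨rfl, by simpa using h'⟩
  · rintro ⟨rfl, h'⟩
    exact ⟨by simp, by simpa using h'⟩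

theorem nonempty_tableau {n : ℕ} {μ : YoungDiagram} (h : μ.cells.card = n) :
    Nonempty (Tableau n μ) :=
  ⟨(Fintype.equivFinOfCardEq (by simpa using h)).symm⟩

theorem nonempty_tableau_rowShape (n : ℕ) : Nonempty (Tableau n (rowShape n)) := by
  apply nonempty_tableau
  have : (rowShape n).cells = {0} ×ˢ Finset.range n := by
    ext c
    rw [mem_rowShape, Finset.mem_product, Finset.mem_singleton, Finset.mem_range]
  rw [this]
  simp

/-- All columns have length one, so the column stabilizer is trivial, and there is a single tabloid.
-/
theorem polytabloid_rowShape {n : ℕ} (T : Tableau n (rowShape n)) :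
    polytabloid F T = Finsupp.single (fun _ => 0) 1 := by
  classical
  have hrow : T.row = fun _ => 0 := funext fun i => (mem_rowShape.1 (T i).2).1
  rw [polytabloid, Finset.sum_eq_single 1]
  · rw [hrow, map_one]
    simp
  · intro γ hγ hne
    refine absurd (Equiv.ext fun i => ?_) hne
    apply T.injective
    apply Subtype.ext
    exact Prod.ext (((mem_rowShape.1 (T (γ i)).2).1).trans (mem_rowShape.1 (T i).2).1.symm)
      ((Finset.mem_filter.1 hγ).2 i)
  · intro h
    simp at h

theorem irrChar_rowShape (n : ℕ) (σ : Perm (Fin n)) : irrChar F n (rowShape n) σ = 1 := by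
  have hspan : specht F n (rowShape n) = Submodule.span F {Finsupp.single (fun _ => 0) 1} := by
    rw [specht]
    congr 1
    have := nonempty_tableau_rowShape n
    simp only [polytabloid_rowShape, Set.range_const]
  have hid : (tabloidRep F n).subrepresentation (specht F n (rowShape n))
      (specht_invariant F n (rowShape n)) σ = LinearMap.id := by
    apply LinearMap.ext
    rintro ⟨v, hv⟩
    apply Subtype.ext
    change tabloidRep F n σ v = v
    rw [hspan] at hv
    obtain ⟨c, rfl⟩ := Submodule.mem_span_singleton.1 hv
    rw [map_smul, tabloidRep_single]
    rfl
  have hrank : Module.finrank F (specht F n (rowShape n)) = 1 := by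
    rw [hspan]
    exact finrank_span_singleton (by simp)
  rw [irrChar, Representation.character, hid]
  have := Module.Free.of_divisionRing F (specht F n (rowShape n))
  have : Module.Finite F (specht F n (rowShape n)) :=
    Module.finite_of_finrank_eq_succ hrank
  have htr := LinearMap.trace_id F (specht F n (rowShape n))
  rw [hrank, Nat.cast_one] at htr
  exact htr

theorem mem_hookShape {n : ℕ} (hn : 2 ≤ n) {c : ℕ × ℕ} :
    c ∈ (hookShape n hn).cells ↔ c = (1, 0) ∨ c.1 = 0 ∧ c.2 < n - 1 := by
  rw [YoungDiagram.mem_cells, hookShape, YoungDiagram.mem_ofRowLens]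
  obtain ⟨i, j⟩ := c
  constructor
  · rintro ⟨h, h'⟩
    have h : i < 2 := h
    interval_cases i
    · exact Or.inr ⟨rfl, h'⟩
    · left
      have h' : j < 1 := h'
      simpa using h'
  · rintro (h | ⟨rfl, h'⟩)
    · cases h
      exact ⟨by simp, by simp⟩
    · exact ⟨by simp, by simpa using h'⟩

/-- Any tableau can be corrected by two transpositions. This makes every difference of two basis
vectors of `Fⁿ` correspond to a polytabloid. -/
theorem exists_tableau_hookShape {n : ℕ} (hn : 2 ≤ n) {p q : Fin n} (hpq : p ≠ q) :
    ∃ T : Tableau n (hookShape n hn), (T p).1 = (1, 0) ∧ (T q).1 = (0, 0) := by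
  have hcard : (hookShape n hn).cells.card = n := by
    have : (hookShape n hn).cells = insert (1, 0) ({0} ×ˢ Finset.range (n - 1)) := by
      ext c
      rw [mem_hookShape hn, Finset.mem_insert, Finset.mem_product, Finset.mem_singleton,
        Finset.mem_range]
    rw [this, Finset.card_insert_of_notMem (by simp)]
    simp
    omega
  obtain ⟨T⟩ := nonempty_tableau hcard
  let c : (hookShape n hn).cells := ⟨(0, 0), (mem_hookShape hn).2 (Or.inr ⟨rfl, by omega⟩)⟩
  let d : (hookShape n hn).cells := ⟨(1, 0), (mem_hookShape hn).2 (Or.inl rfl)⟩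
  have hcd : c ≠ d := fun h => by simpa [c, d] using congrArg (fun x => x.1.1) h
  let T' : Tableau n (hookShape n hn) := (swap q (T.symm c)).trans T
  have hq : T' q = c := by simp [T']
  refine ⟨(swap p (T'.symm d)).trans T', ?_, ?_⟩
  · simp [d]
  -- The second transposition does not disturb `q`, which already sits in the corner.
  · have h1 : q ≠ T'.symm d := fun h => hcd (by rw [← hq, h, apply_symm_apply])
    rw [Equiv.trans_apply, swap_apply_of_ne_of_ne hpq.symm h1, hq]

/-- The linear map from `Fⁿ` to the span of the tabloids that sends the `i`-th basis vector to the
tabloid with the entry `i` in the second row and all other entries in the first row. -/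
def hookTabloid (n : ℕ) : (Fin n → F) →ₗ[F] ((Fin n → ℕ) →₀ F) :=
  Fintype.linearCombination F fun i => Finsupp.single (Pi.single i 1) 1

theorem hookTabloid_single {n : ℕ} (i : Fin n) :
    hookTabloid F n (Pi.single i 1) = Finsupp.single (Pi.single i 1) 1 := by
  simp [hookTabloid]

theorem hookTabloid_injective (n : ℕ) : Function.Injective (hookTabloid F n) := by
  rw [← LinearMap.ker_eq_bot]
  refine LinearMap.ker_eq_bot'.2 fun v hv => ?_
  funext i
  have h := DFunLike.congr_fun hv (Pi.single i 1)
  rw [hookTabloid, Fintype.linearCombination_apply, Finsupp.finsetSum_apply,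
    Finset.sum_eq_single i] at h
  · simpa using h
  · intro j _ hj
    have : (Pi.single j 1 : Fin n → ℕ) ≠ Pi.single i 1 := by
      intro h
      have := congrFun h j
      simp [hj] at this
    simp [this]
  · simp

theorem hookTabloid_funLeft {n : ℕ} (σ : Perm (Fin n)) (v : Fin n → F) :
    hookTabloid F n (LinearMap.funLeft F F (σ⁻¹ : Perm (Fin n)) v) =
      tabloidRep F n σ (hookTabloid F n v) := by
  have key : hookTabloid F n ∘ₗ LinearMap.funLeft F F (σ⁻¹ : Perm (Fin n)) =
      tabloidRep F n σ ∘ₗ hookTabloid F n := by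
    apply (Pi.basisFun F (Fin n)).ext
    intro i
    have hN : (Pi.single i 1 : Fin n → ℕ) ∘ ⇑σ⁻¹ = Pi.single (σ i) 1 := by
      funext k
      simp only [Function.comp_apply, Pi.single_apply, Perm.inv_def, symm_apply_eq]
    have hF : LinearMap.funLeft F F (σ⁻¹ : Perm (Fin n)) (Pi.single i 1) = Pi.single (σ i) 1 := by
      funext k
      simp only [LinearMap.funLeft_apply, Pi.single_apply, Perm.inv_def, symm_apply_eq]
    rw [Pi.basisFun_apply, LinearMap.comp_apply, LinearMap.comp_apply, hookTabloid_single,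
      tabloidRep_single, hN, hF, hookTabloid_single]
  exact congrArg (fun f => f v) key

/-- Only the first column has two cells, with entries `q` and `p`, so the column stabilizer is `{1,
(p q)}`. -/
theorem polytabloid_hookShape {n : ℕ} (hn : 2 ≤ n) (T : Tableau n (hookShape n hn)) {p q : Fin n}
    (hp : (T p).1 = (1, 0)) (hq : (T q).1 = (0, 0)) :
    polytabloid F T = hookTabloid F n (Pi.single p 1 - Pi.single q 1) := by
  classical
  have hpq : p ≠ q := by
    rintro rfl
    rw [hp] at hq
    simp at hq
  have hrow : T.row = Pi.single p 1 := by
    funext i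
    by_cases hi : i = p
    · subst hi
      simp [Tableau.row, hp]
    · rw [Pi.single_eq_of_ne hi]
      rcases (mem_hookShape hn).1 (T i).2 with h | h
      · exact absurd (T.injective (Subtype.ext (h.trans hp.symm))) hi
      · exact h.1
  -- Entries other than `p` lie in the first row, where the column determines the entry.
  have hcol : ∀ i j, T.col i = T.col j → i ≠ p → j ≠ p → i = j := by
    intro i j h hi hj
    have hi' := congrFun hrow i
    have hj' := congrFun hrow j
    rw [Pi.single_eq_of_ne hi] at hi'
    rw [Pi.single_eq_of_ne hj] at hj'
    exact T.injective (Subtype.ext (Prod.ext (hi'.trans hj'.symm) h))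
  have hcp : T.col p = 0 := by simp [Tableau.col, hp]
  have hcq : T.col q = 0 := by simp [Tableau.col, hq]
  have hstab : (Finset.univ.filter fun γ : Perm (Fin n) => ∀ i, T.col (γ i) = T.col i) =
      {1, swap p q} := by
    ext γ
    simp only [Finset.mem_filter, Finset.mem_univ, true_and, Finset.mem_insert,
      Finset.mem_singleton]
    constructor
    · intro h
      by_cases hγ : γ p = p
      · left
        ext1 i
        by_cases hi : i = p
        · rw [hi, hγ]; rfl
        · exact hcol _ _ (h i) (fun h' => hi (γ.injective (h'.trans hγ.symm))) hi
      · right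
        have h1 : γ p = q := hcol _ _ ((h p).trans (hcp.trans hcq.symm)) hγ hpq.symm
        have h2 : γ q = p := by
          by_contra h'
          exact hpq (γ.injective (h1.trans (hcol _ _ (h q) h' hpq.symm).symm))
        ext1 i
        by_cases hi : i = p
        · rw [hi, h1, swap_apply_left]
        · by_cases hi' : i = q
          · rw [hi', h2, swap_apply_right]
          · rw [swap_apply_of_ne_of_ne hi hi']
            exact hcol _ _ (h i) (fun h' => hi' (γ.injective (h'.trans h2.symm))) hi
    · rintro (rfl | rfl) i
      · rfl
      · by_cases hi : i = p
        · rw [hi, swap_apply_left, hcp, hcq]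
        · by_cases hi' : i = q
          · rw [hi', swap_apply_right, hcp, hcq]
          · rw [swap_apply_of_ne_of_ne hi hi']
  have hne : (1 : Perm (Fin n)) ≠ swap p q := by
    intro h
    apply hpq
    have := congrArg (fun γ : Perm (Fin n) => γ p) h
    simpa using this
  have hsw : (Pi.single p 1 : Fin n → ℕ) ∘ ⇑(swap p q)⁻¹ = Pi.single q 1 := by
    funext k
    simp only [Function.comp_apply, Pi.single_apply, swap_inv]
    congr 1
    rw [eq_iff_iff, ← (swap p q).injective.eq_iff (b := q)]
    simp
  rw [polytabloid]
  convert Finset.sum_congr hstab fun _ _ => rfl using 1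
  rw [Finset.sum_pair hne, hrow, tabloidRep_single, tabloidRep_single, hsw, map_sub,
    hookTabloid_single, hookTabloid_single, Perm.sign_swap hpq]
  simp [sub_eq_add_neg]

/-- The vectors with coordinate sum zero. -/
def sumZero (n : ℕ) : Submodule F (Fin n → F) :=
  LinearMap.ker (∑ i, LinearMap.proj i : (Fin n → F) →ₗ[F] F)

theorem mem_sumZero {n : ℕ} {v : Fin n → F} : v ∈ sumZero F n ↔ ∑ i, v i = 0 := by
  simp [sumZero, LinearMap.sum_apply]

theorem map_hookTabloid_sumZero {n : ℕ} (hn : 2 ≤ n) :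
    (sumZero F n).map (hookTabloid F n) = specht F n (hookShape n hn) := by
  apply le_antisymm
  · rintro _ ⟨v, hv, rfl⟩
    have hv : ∑ i, v i = 0 := (mem_sumZero F).1 hv
    let o : Fin n := ⟨0, by omega⟩
    -- The correction term is `(∑ v_i)` times the basis vector at `o`, which is zero.
    have : v = ∑ i, v i • (Pi.single i 1 - Pi.single o 1 : Fin n → F) := by
      simp only [smul_sub, Finset.sum_sub_distrib, ← Finset.sum_smul, hv, zero_smul, sub_zero]
      exact (pi_eq_sum_univ' v)
    rw [this, map_sum]
    refine Submodule.sum_mem _ fun i _ => ?_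
    rw [map_smul]
    apply Submodule.smul_mem
    by_cases hi : i = o
    · rw [hi, sub_self, map_zero]
      exact Submodule.zero_mem _
    · obtain ⟨T, hp, hq⟩ := exists_tableau_hookShape hn hi
      rw [← polytabloid_hookShape F hn T hp hq]
      exact Submodule.subset_span ⟨T, rfl⟩
  · rw [specht, Submodule.span_le]
    rintro _ ⟨T, rfl⟩
    refine ⟨_, ?_, (polytabloid_hookShape F hn T
      (p := T.symm ⟨(1, 0), (mem_hookShape hn).2 (Or.inl rfl)⟩)
      (q := T.symm ⟨(0, 0), (mem_hookShape hn).2 (Or.inr ⟨rfl, by omega⟩)⟩)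
      (by rw [apply_symm_apply]) (by rw [apply_symm_apply])).symm⟩
    rw [SetLike.mem_coe, mem_sumZero]
    simp [Finset.sum_sub_distrib]

/-- Subtracting from the permutation operator the rank-one map `v ↦ (∑ v_i / n)(1, …, 1)`, of trace
`1`, gives an operator `g` that agrees with it on sum-zero vectors and maps all of `Fⁿ` into them.
So the trace of `g` on `Fⁿ` is already that of its restriction. -/
theorem irrChar_hookShape [CharZero F] {n : ℕ} (hn : 2 ≤ n) (σ : Perm (Fin n)) :
    irrChar F n (hookShape n hn) σ = permTrace F σ - 1 := by
  have hn0 : (n : F) ≠ 0 := Nat.cast_ne_zero.2 (by omega)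
  let s : (Fin n → F) →ₗ[F] F := ∑ i, LinearMap.proj i
  have hs : ∀ v, s v = ∑ i, v i := fun v => by simp [s, LinearMap.sum_apply]
  let P : Module.End F (Fin n → F) := LinearMap.funLeft F F (σ⁻¹ : Perm (Fin n))
  have hsP : ∀ v, s (P v) = s v := fun v => by
    rw [hs, hs]
    exact Equiv.sum_comp (σ⁻¹ : Perm (Fin n)) v
  let g : Module.End F (Fin n → F) := P - s.smulRight (fun _ => (n : F)⁻¹)
  have hg : ∀ v, g v ∈ sumZero F n := by
    intro v
    change s (g v) = 0
    simp only [g, LinearMap.sub_apply, LinearMap.smulRight_apply, map_sub, hsP, map_smul]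
    rw [hs fun _ => (n : F)⁻¹]
    simp [hn0]
  have htr : LinearMap.trace F _ g = permTrace F σ - 1 := by
    rw [map_sub, LinearMap.trace_smulRight, hs]
    simp [hn0]
    rfl
  let φ : sumZero F n ≃ₗ[F] specht F n (hookShape n hn) :=
    ((sumZero F n).equivMapOfInjective _ (hookTabloid_injective F n)).trans
      (LinearEquiv.ofEq _ _ (map_hookTabloid_sumZero F hn))
  have hφ : ∀ v, (φ v : (Fin n → ℕ) →₀ F) = hookTabloid F n v := fun v => rfl
  rw [← htr, ← LinearMap.trace_restrict_eq_of_forall_mem (sumZero F n) g hg, irrChar,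
    Representation.character]
  refine Eq.trans ?_ (LinearMap.trace_conj' (N := specht F n (hookShape n hn)) _ φ)
  congr 1
  apply LinearMap.ext
  intro v
  obtain ⟨v, rfl⟩ := φ.surjective v
  rw [LinearEquiv.conj_apply_apply, LinearEquiv.symm_apply_apply]
  apply Subtype.ext
  rw [hφ]
  change tabloidRep F n σ (hookTabloid F n v) = hookTabloid F n (g v)
  rw [← hookTabloid_funLeft]
  congr 1
  have hv : s v = 0 := v.2
  simp only [g, LinearMap.sub_apply, LinearMap.smulRight_apply, hv, zero_smul, sub_zero]
  rfl

theorem permTrace_one (σ : Perm (Fin 1)) : permTrace F σ = 1 := by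
  rw [permTrace, Subsingleton.elim σ 1]
  have : LinearMap.funLeft F F (((1 : Perm (Fin 1))⁻¹ : Perm (Fin 1)) : Fin 1 → Fin 1) =
      LinearMap.id := rfl
  rw [this, LinearMap.trace_id]
  simp

end SpechtCharacters

end DiffPI

end

theorem mainTheorem3 {F : Type*} [Field F] [CharZero F] {L : Type*} [LieRing L] [LieAlgebra F L]
    (ρ : L →ₗ⁅F⁆ DiffPI.Der F (DiffPI.algC F)) (e : L) (he : ρ e = DiffPI.eps F)
    {I : Type*} (b : Module.Basis I F (UniversalEnvelopingAlgebra F L)) :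
    -- `ε` spans `Der(C)`, so `L` acts on `C` as the Lie algebra `Der(C)`
    (∀ D : DiffPI.Der F (DiffPI.algC F), ∃ c : F, D = c • DiffPI.eps F) ∧
    -- the identities, when `L` is `Der(C)` itself
    (Function.Injective ρ → DiffPI.diffId ρ b = DiffPI.tlSpan b (DiffPI.gensC b e)) ∧
    -- the identities for any `L`, where the trivial ones `x^γ`, `γ ∈ ker ρ`, have to be listed
    DiffPI.diffId ρ b = DiffPI.tlSpan b (DiffPI.gensC b e ∪
      {f | ∃ γ : L, ρ γ = 0 ∧ f = DiffPI.var b 0 (UniversalEnvelopingAlgebra.ι F γ)}) ∧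
    -- the codimensions, and their linear growth
    (∀ n : ℕ, 1 ≤ n → DiffPI.codim ρ b n = ((n + 1 : ℕ) : Cardinal)) ∧
    (fun n : ℕ => ((DiffPI.codim ρ b n).toNat : ℝ)) =Θ[Filter.atTop] (fun n : ℕ => (n : ℝ)) ∧
    -- the cocharacters; there is no partition `(n - 1, 1)` for `n = 1`
    (∀ (n : ℕ) (hn : 2 ≤ n), DiffPI.cocharacter ρ b n =
      2 • DiffPI.irrChar F n (DiffPI.rowShape n) + DiffPI.irrChar F n (DiffPI.hookShape n hn)) ∧
    DiffPI.cocharacter ρ b 1 = 2 • DiffPI.irrChar F 1 (DiffPI.rowShape 1) := by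
  refine ⟨DiffPI.exists_eq_smul_eps, DiffPI.diffId_eq_tlSpan_of_injective he b,
    DiffPI.diffId_eq_tlSpan he b, fun n hn => DiffPI.codim_eq he b hn, ?_, ?_, ?_⟩
  · constructor
    -- `n + 1 ≤ 2n` for `n ≥ 1`.
    · refine Asymptotics.IsBigO.of_bound 2 ?_
      filter_upwards [Filter.eventually_ge_atTop 1] with n hn
      rw [DiffPI.codim_eq he b hn, Cardinal.toNat_natCast, Real.norm_natCast, Real.norm_natCast]
      have : (1 : ℝ) ≤ n := by exact_mod_cast hn
      push_cast
      linarith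
    · refine Asymptotics.IsBigO.of_bound 1 ?_
      filter_upwards [Filter.eventually_ge_atTop 1] with n hn
      rw [DiffPI.codim_eq he b hn, Cardinal.toNat_natCast, Real.norm_natCast, Real.norm_natCast]
      push_cast
      linarith
  -- With `π` the permutation character, `1 + π = 2 · 1 + (π - 1)`.
  · intro n hn
    funext σ
    rw [Pi.add_apply, Pi.smul_apply, DiffPI.cocharacter_eq he b (by omega),
      DiffPI.irrChar_rowShape, DiffPI.irrChar_hookShape]
    rw [nsmul_eq_mul]
    push_cast
    ring
  -- For `n = 1` the permutation module is itself trivial.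
  · funext σ
    rw [Pi.smul_apply, DiffPI.cocharacter_eq he b le_rfl, DiffPI.irrChar_rowShape,
      DiffPI.permTrace_one, nsmul_eq_mul]
    push_cast
    ring
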